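/- All graphs are finite and simple. For a connected graph $G$ and a proper colouring $c$ of $G$ with nonempty classes $V_1,\dots,V_k$, the colour code of a vertex $v$ is $(d(v,V_1),\dots,d(v,V_k))$; $c$ is a locating colouring if distinct vertices have distinct colour codes, and $\chi_L(G)$ is the least number of colours of a locating colouring. A proper colouring is distinguishing if the identity is the only automorphism of $G$ that preserves all colours, and $\chi_D(G)$ is the least number of colours of a distinguishing colouring. Figures. Take three vertices $D_0,D_1,D_2$ (hubs). For $i\ne j$ let the rail $R_{ij}$ be a path with $\ell_{ij}\ge 0$ edges starting at $D_i$ (its point of level $0$); the six rails are disjoint apart from their hubs. A rung at level $n$ between $R_{ij}$ and $R_{ji}$, where $0\le n\le\min(\ell_{ij},\ell_{ji})$, is an edge joining the points of level $n$ of these two rails (for $n=0$: the edge $D_iD_j$). A ladder between $D_i$ and $D_j$ with lowest level $r_{ij}=r_{ji}\le\min(\ell_{ij},\ell_{ji})$ consists of $R_{ij}$, $R_{ji}$ and all rungs at levels $r_{ij}\le n\le \min(\ell_{ij},\ell_{ji})$. The bipartite figure: $D_0$ is the middle hub, and there are no rungs between $R_{12}$ and $R_{21}$. For each of $(i,j)=(1,2),(2,1)$,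 either there is a ladder between $D_0$ and $D_i$, and $R_{ij}$ is a pendant path with $\ell_{ij}\ge1$ edges; or $D_i$ with its rails is missing, there is no rung on this side, and $R_{0i}$ is a pendant path with $\ell_{0i}\ge 1$ edges. Its blue edges are all edges of the rails and the lowest rung of each ladder. The non-bipartite figures: there are ladders between all three pairs of hubs. Figures (A), (B), (C), (D) are the cases in which exactly $0,1,2,3$ of the numbers $r_{01},r_{02},r_{12}$ are positive. The blue cycle $C_m$, $m=\sum_{i<j}(2r_{ij}+1)$, consists of the three lowest rungs and the parts of the rails up to them. Theorem. A connected graph $G$ satisfies $\chi_D(G)=\chi_L(G)=3$ if and only if one of the following holds. 1. $G$ is isomorphic to a subgraph $H$ of the bipartite figure, for some values of the parameters, such that $H$ contains all blue edges, $|\mathrm{Aut}(H)|\ge 2$, and, moreover, some non-identity automorphism of $H$ maps each class of the bipartition of $H$ to itself. 2. $G$ is isomorphic to a subgraph $H$ of one of the non-bipartite figures (A)–(D), for some values of the parameters, such that $H$ contains all rails and contains the blue cycle $C_m$, and $C_m$ is a smallest odd cycle of $H$. -/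

import Mathlib

/-- `colorDist G c v i` is the distance `d(v, V_i)` from `v` to the colour class `V_i` of `c`
(used for connected graphs and nonempty classes, so that the infimum is a minimum). -/
noncomputable def SimpleGraph.colorDist {V : Type*} {k : ℕ} (G : SimpleGraph V)
    (c : G.Coloring (Fin k)) (v : V) (i : Fin k) : ℕ :=
  sInf ((fun u => G.dist v u) '' {u | c u = i})

/-- A proper `k`-colouring with `k` nonempty classes is locating if distinct vertices have
distinct colour codes `(d(v, V_1), …, d(v, V_k))`. -/
def SimpleGraph.IsLocating {V : Type*} {k : ℕ} (G : SimpleGraph V)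
    (c : G.Coloring (Fin k)) : Prop :=
  Function.Surjective c ∧ Function.Injective (fun v => G.colorDist c v)

/-- The locating chromatic number. -/
noncomputable def SimpleGraph.locatingChromaticNumber {V : Type*} (G : SimpleGraph V) : ℕ :=
  sInf {k : ℕ | ∃ c : G.Coloring (Fin k), G.IsLocating c}

/-- A proper `k`-colouring is distinguishing if the identity is the only automorphism
that preserves the colours. -/
def SimpleGraph.IsDistinguishing {V : Type*} {k : ℕ} (G : SimpleGraph V)
    (c : G.Coloring (Fin k)) : Prop :=
  ∀ φ : G ≃g G, (∀ v, c (φ v) = c v) → ∀ v, φ v = v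

/-- The distinguishing chromatic number. -/
noncomputable def SimpleGraph.distinguishingChromaticNumber {V : Type*} (G : SimpleGraph V) : ℕ :=
  sInf {k : ℕ | ∃ c : G.Coloring (Fin k), G.IsDistinguishing c}

/-- The points in which all graphs of the figures are drawn: three hubs `0, 1, 2`, and, for
`i ≠ j`, the points of a rail that starts at hub `i` and runs in the direction `(i, j)`.
The rails `(i, j)` and `(j, i)` are the two sides of the ladder between the hubs `i` and `j`. -/
inductive FigurePoint : Type
  | hub (i : Fin 3) : FigurePoint
  | inner (i j : Fin 3) (n : ℕ) : FigurePoint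

/-- The point at level `n` of the rail `(i, j)`; level `0` is the hub `i`. -/
def railPoint (i j : Fin 3) : ℕ → FigurePoint
  | 0 => FigurePoint.hub i
  | n + 1 => FigurePoint.inner i j n

/-- The rung at level `n` of the ladder between the hubs `i` and `j`
(for `n = 0` it joins the two hubs). -/
def rung (i j : Fin 3) (n : ℕ) : Sym2 FigurePoint :=
  s(railPoint i j n, railPoint j i n)

/-- All edges of the rails, where the rail `(i, j)` has `len i j` edges. -/
def railEdges (len : Fin 3 → Fin 3 → ℕ) : Set (Sym2 FigurePoint) :=
  {e | ∃ i j : Fin 3, ∃ n : ℕ, i ≠ j ∧ n < len i j ∧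
    e = s(railPoint i j n, railPoint i j (n + 1))}

/-- The parameters of the bipartite figure. The middle hub is `0`, the outer hubs are `1` and `2`.
If `hasLadder i`, then the outer hub `i` is present, there is a ladder between `0` and `i`
with lowest rung at level `low i`, and the rail at `i` that points to the other outer hub is a
pendant path with at least one edge. If not, this side of the figure
is only a pendant path at the middle hub. -/
structure BipartiteShape where
  len : Fin 3 → Fin 3 → ℕ
  hasLadder : Fin 3 → Prop
  low : Fin 3 → ℕ
  low_le : ∀ i, i ≠ 0 → hasLadder i → low i ≤ len 0 i ∧ low i ≤ len i 0
  tail_pos : ∀ i j, i ≠ 0 → j ≠ 0 → i ≠ j → hasLadder i → 1 ≤ len i j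
  path_pos : ∀ i, i ≠ 0 → ¬ hasLadder i → 1 ≤ len 0 i
  no_rail : ∀ i j, i ≠ 0 → i ≠ j → ¬ hasLadder i → len i j = 0

/-- The blue edges of the bipartite figure: all rails, and the lowest rung of every ladder. -/
def BipartiteShape.blueEdges (S : BipartiteShape) : Set (Sym2 FigurePoint) :=
  railEdges S.len ∪ {e | ∃ i : Fin 3, i ≠ 0 ∧ S.hasLadder i ∧ e = rung 0 i (S.low i)}

/-- All rungs of the bipartite figure: those from the lowest level up to the end of the
shorter rail. -/
def BipartiteShape.rungEdges (S : BipartiteShape) : Set (Sym2 FigurePoint) :=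
  {e | ∃ i : Fin 3, ∃ n : ℕ, i ≠ 0 ∧ S.hasLadder i ∧
    S.low i ≤ n ∧ n ≤ S.len 0 i ∧ n ≤ S.len i 0 ∧ e = rung 0 i n}

/-- The bipartite figure. -/
def BipartiteShape.figure (S : BipartiteShape) : SimpleGraph FigurePoint :=
  SimpleGraph.fromEdgeSet (railEdges S.len ∪ S.rungEdges)

/-- The parameters of the non-bipartite figures: three ladders, one between any two of the three
hubs, where the ladder between `i` and `j` has its lowest rung at level `low i j`.
The figures (A), (B), (C), (D) are the cases in which
exactly 0, 1, 2, 3 of the three ladders have a positive lowest level. -/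
structure NonbipartiteShape where
  len : Fin 3 → Fin 3 → ℕ
  low : Fin 3 → Fin 3 → ℕ
  low_symm : ∀ i j, low i j = low j i
  low_le : ∀ i j, i ≠ j → low i j ≤ len i j

/-- All rungs of a non-bipartite figure. -/
def NonbipartiteShape.rungEdges (S : NonbipartiteShape) : Set (Sym2 FigurePoint) :=
  {e | ∃ i j : Fin 3, ∃ n : ℕ, i ≠ j ∧
    S.low i j ≤ n ∧ n ≤ S.len i j ∧ n ≤ S.len j i ∧ e = rung i j n}

/-- A non-bipartite figure. -/
def NonbipartiteShape.figure (S : NonbipartiteShape) : SimpleGraph FigurePoint :=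
  SimpleGraph.fromEdgeSet (railEdges S.len ∪ S.rungEdges)

/-- The edges of the blue cycle `C_m`: the three lowest rungs and the parts of the rails
below them. -/
def NonbipartiteShape.blueCycleEdges (S : NonbipartiteShape) : Set (Sym2 FigurePoint) :=
  railEdges S.low ∪ {e | ∃ i j : Fin 3, i ≠ j ∧ e = rung i j (S.low i j)}

/-- `E` is the edge set of a smallest odd cycle of `G`. -/
def SimpleGraph.IsSmallestOddCycle {V : Type*} (G : SimpleGraph V) (E : Set (Sym2 V)) : Prop :=
  ∃ (v : V) (C : G.Walk v v), C.IsCycle ∧ Odd C.length ∧ {e | e ∈ C.edges} = E ∧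
    ∀ (w : V) (C' : G.Walk w w), C'.IsCycle → Odd C'.length → C.length ≤ C'.length

/-- `H` is a subgraph of the bipartite figure that contains all blue edges. -/
def BipartiteShape.IsMember (S : BipartiteShape) (H : S.figure.Subgraph) : Prop :=
  S.blueEdges ⊆ H.edgeSet

/-- `H` is a subgraph of a non-bipartite figure that contains all rails and in which the blue
cycle is present and is a smallest odd cycle. -/
def NonbipartiteShape.IsMember (S : NonbipartiteShape) (H : S.figure.Subgraph) : Prop :=
  railEdges S.len ⊆ H.edgeSet ∧ S.blueCycleEdges ⊆ H.edgeSet ∧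
    H.spanningCoe.IsSmallestOddCycle S.blueCycleEdges

/-- Some non-identity automorphism of `H` maps every class of some proper 2-colouring
to itself (for a connected bipartite graph the 2-colouring is unique up to its names). -/
def SimpleGraph.HasSidePreservingAut {V : Type*} (H : SimpleGraph V) : Prop :=
  ∃ (c : H.Coloring (Fin 2)) (φ : H ≃g H), (∃ v, φ v ≠ v) ∧ ∀ v, c (φ v) = c v

/-! Let `c` be a locating 3-colouring of a connected graph. The code of a vertex is 0 at its own
colour and, because the vertex has a neighbour, 1 at another colour, so its entries are 0, 1 and n +
1 in some order. Such a code is a point of the figures: level n of the rail (i, j), where i and j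
are the colours with entries 0 and 1, ordered by the parity of n. For n = 0 two entries are 1, both
readings give the same point, and this is a hub. Along an edge every entry changes by at most one,
so edges become rail edges or rungs, and a geodesic to the third colour runs down the rail
(`IsLocating.exists_isDrawing`). Conversely, a walk in a drawing can leave a ladder only through a
hub, so levels are recovered from distances and the colours of the points are locating
(`IsDrawing.isLocating`).

A locating colouring is distinguishing, so both numbers are 3 exactly when there is a locating
3-colouring but no distinguishing 2-colouring (`Connected.numbers_eq_three_iff`). The second
condition holds for every non-bipartite graph; for a connected bipartite graph, whose 2-colouring is
unique up to names, it asks for a non-identity automorphism that preserves the sides.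

It remains to sort the drawings (`IsDrawing.exists_shape`). If every two hubs are joined by a rung,
the drawing is non-bipartite. Otherwise connectedness provides a middle hub and a bipartite figure.
That the blue cycle is a smallest odd cycle is automatic: folding every ladder onto its lowest rung
maps the figure homomorphically to C_m, where odd closed walks have length at least m
(`isSmallestOddCycle`). -/

/-! ### Points of the figures and their colours -/

namespace FigurePoint

/-- The colour of a point: the rail `(i, j)` is coloured `i, j, i, j, …` from its hub on. -/
def color : FigurePoint → Fin 3
  | hub i => i
  | inner i j n => if Even n then j else i

/-- Renaming of the three hubs. -/
def relabel (σ : Equiv.Perm (Fin 3)) : FigurePoint → FigurePoint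
  | hub i => hub (σ i)
  | inner i j n => inner (σ i) (σ j) n

/-- The hub at which the rail of a point starts. -/
def home : FigurePoint → Fin 3
  | hub i => i
  | inner i _ _ => i

end FigurePoint

open FigurePoint

theorem color_railPoint (i j : Fin 3) (n : ℕ) :
    (railPoint i j n).color = if Even n then i else j := by
  cases n with
  | zero => simp [railPoint, color]
  | succ n => by_cases h : Even n <;> simp [railPoint, color, Nat.even_add_one, h]

theorem color_railPoint_succ (i j : Fin 3) (n : ℕ) :
    (railPoint i j (n + 1)).color = (railPoint j i n).color := by
  by_cases hn : Even n <;> simp [color_railPoint, Nat.even_add_one, hn]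

theorem home_railPoint (i j : Fin 3) (n : ℕ) : (railPoint i j n).home = i := by
  cases n <;> rfl

theorem relabel_railPoint (σ : Equiv.Perm (Fin 3)) (i j : Fin 3) (n : ℕ) :
    (railPoint i j n).relabel σ = railPoint (σ i) (σ j) n := by
  cases n <;> rfl

theorem relabel_symm_relabel (σ : Equiv.Perm (Fin 3)) (p : FigurePoint) :
    (p.relabel σ).relabel σ.symm = p := by
  cases p <;> simp [relabel]

theorem color_relabel (σ : Equiv.Perm (Fin 3)) (p : FigurePoint) :
    (p.relabel σ).color = σ p.color := by
  cases p with
  | hub i => rfl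
  | inner i j n => by_cases h : Even n <;> simp [relabel, color, h]

theorem railPoint_zero (i j : Fin 3) : railPoint i j 0 = hub i := rfl

theorem railPoint_inj {i j i' j' : Fin 3} {n n' : ℕ} :
    railPoint i j n = railPoint i' j' n' ↔ i = i' ∧ n = n' ∧ (n = 0 ∨ j = j') := by
  cases n <;> cases n' <;> simp [railPoint]
  tauto

/-- The third of the three hubs. -/
def thirdHub (i j : Fin 3) : Fin 3 := -(i + j)

theorem thirdHub_comm (i j : Fin 3) : thirdHub i j = thirdHub j i := by
  simp [thirdHub, add_comm]

/-- Since 0 + 1 + 2 = 0 in `Fin 3`, the negated sum of two distinct elements is the remaining one.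
-/
theorem thirdHub_ne_left {i j : Fin 3} (h : i ≠ j) : thirdHub i j ≠ i := by
  revert i j; decide

theorem thirdHub_ne_right {i j : Fin 3} (h : i ≠ j) : thirdHub i j ≠ j := by
  revert i j; decide

theorem eq_or_eq_or_eq_thirdHub {i j : Fin 3} (h : i ≠ j) (x : Fin 3) :
    x = i ∨ x = j ∨ x = thirdHub i j := by
  revert i j x; decide

/-! ### Colour codes as points -/

/-- `d` is the colour code of the point at level `n` of the rail `(i, j)`. -/
structure IsCodeAt (d : Fin 3 → ℕ) (i j : Fin 3) (n : ℕ) : Prop where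
  ne : i ≠ j
  self : d (railPoint i j n).color = 0
  other : d (railPoint j i n).color = 1
  third : d (thirdHub i j) = n + 1

namespace IsCodeAt

theorem self_iff {d : Fin 3 → ℕ} {i j : Fin 3} {n : ℕ} (h : IsCodeAt d i j n) (x : Fin 3) :
    d x = 0 ↔ (railPoint i j n).color = x := by
  obtain ⟨hne, hs, ho, ht⟩ := h
  constructor
  · intro hx
    rw [color_railPoint] at *
    rcases eq_or_eq_or_eq_thirdHub hne x with rfl | rfl | rfl
    · by_contra hcon
      split_ifs at * <;> simp_all
    · by_contra hcon
      split_ifs at * <;> simp_all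
    · omega
  · rintro rfl; exact hs

/-- The zero entry gives the colour of the point. If the third hubs agree, the third entry gives the
level, and colour and parity then fix the direction of the rail. If they differ, each third entry is
a 0 or 1 of the other description, so both levels are 0 and the colour names the hub. -/
theorem point_unique {d : Fin 3 → ℕ} {i j i' j' : Fin 3} {n n' : ℕ}
    (h : IsCodeAt d i j n) (h' : IsCodeAt d i' j' n') :
    railPoint i j n = railPoint i' j' n' := by
  have hs := (h.self_iff _).1 h'.self
  rw [railPoint_inj]
  obtain ⟨hne, hs1, ho, ht⟩ := h
  obtain ⟨hne', hs1', ho', ht'⟩ := h'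
  simp only [color_railPoint] at *
  by_cases hk : thirdHub i j = thirdHub i' j'
  · rw [hk] at ht
    have hn : n = n' := by omega
    subst hn
    have key : ∀ i j i' j' : Fin 3, i ≠ j → i' ≠ j' → thirdHub i j = thirdHub i' j' →
      (i = i' ↔ j = j') := by decide
    have := key _ _ _ _ hne hne' hk
    split_ifs at hs <;> simp_all
  · have h1 : ∀ i j i' j' : Fin 3, i ≠ j → i' ≠ j' → thirdHub i j ≠ thirdHub i' j' →
      (thirdHub i j = i' ∨ thirdHub i j = j') ∧ (thirdHub i' j' = i ∨ thirdHub i' j' = j) := by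
        decide
    obtain ⟨h1, h2⟩ := h1 _ _ _ _ hne hne' hk
    have hn : n = 0 := by
      rcases h1 with h1 | h1 <;> rw [h1] at ht <;> split_ifs at * <;> omega
    have hn' : n' = 0 := by
      rcases h2 with h2 | h2 <;> rw [h2] at ht' <;> split_ifs at * <;> omega
    subst hn; subst hn'
    simpa using hs

/-- At level 0 the point forgets j, but the code is then 0 at i and 1 elsewhere and does not depend
on j either. -/
theorem code_unique {d d' : Fin 3 → ℕ} {i j i' j' : Fin 3} {n n' : ℕ}
    (h : IsCodeAt d i j n) (h' : IsCodeAt d' i' j' n')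
    (hp : railPoint i j n = railPoint i' j' n') : d = d' := by
  obtain ⟨rfl, rfl, h0⟩ := railPoint_inj.1 hp
  obtain ⟨hne, hs1, ho, ht⟩ := h
  obtain ⟨hne', hs1', ho', ht'⟩ := h'
  simp only [color_railPoint] at *
  funext x
  rcases h0 with rfl | rfl
  · have : ∀ x, x ≠ i → d x = 1 := by
      intro x hx
      rcases eq_or_eq_or_eq_thirdHub hne x with rfl | rfl | rfl <;> simp_all
    have : ∀ x, x ≠ i → d' x = 1 := by
      intro x hx
      rcases eq_or_eq_or_eq_thirdHub hne' x with rfl | rfl | rfl <;> simp_all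
    by_cases hx : x = i <;> simp_all
  · rcases eq_or_eq_or_eq_thirdHub hne x with rfl | rfl | rfl
    · split_ifs at * <;> simp_all
    · split_ifs at * <;> simp_all
    · omega

end IsCodeAt

/-! ### Distances to colour classes -/

namespace SimpleGraph

variable {V : Type*} {G : SimpleGraph V} {k : ℕ}

theorem colorDist_le_dist (c : G.Coloring (Fin k)) (v u : V) :
    G.colorDist c v (c u) ≤ G.dist v u :=
  Nat.sInf_le ⟨u, rfl, rfl⟩

theorem exists_dist_eq_colorDist {c : G.Coloring (Fin k)} (hc : Function.Surjective c)
    (v : V) (i : Fin k) : ∃ u, c u = i ∧ G.dist v u = G.colorDist c v i := by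
  obtain ⟨w, hw⟩ := hc i
  have := Nat.sInf_mem (s := (fun u => G.dist v u) '' {u | c u = i}) ⟨_, w, hw, rfl⟩
  obtain ⟨u, hu, h⟩ := this
  exact ⟨u, hu, h⟩

theorem Connected.colorDist_eq_zero_iff (hG : G.Connected) {c : G.Coloring (Fin k)}
    (hc : Function.Surjective c) {v : V} {i : Fin k} : G.colorDist c v i = 0 ↔ c v = i := by
  constructor
  · intro h
    obtain ⟨u, hu, hd⟩ := exists_dist_eq_colorDist hc v i
    rw [h, hG.dist_eq_zero_iff] at hd
    rw [hd, hu]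
  · rintro rfl
    have h := colorDist_le_dist c v v
    have h0 : G.dist v v = 0 := SimpleGraph.dist_self
    omega

theorem Connected.colorDist_le_of_adj (hG : G.Connected) {c : G.Coloring (Fin k)}
    (hc : Function.Surjective c) {u v : V} (h : G.Adj u v) (i : Fin k) :
    G.colorDist c u i ≤ G.colorDist c v i + 1 := by
  obtain ⟨w, rfl, hd⟩ := exists_dist_eq_colorDist hc v i
  have h1 := colorDist_le_dist c u w
  have h2 : G.dist u w ≤ G.dist u v + G.dist v w := hG.dist_triangle
  rw [dist_eq_one_iff_adj.2 h] at h2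
  omega

/-- Take the first step of a geodesic to a nearest vertex of the class. -/
theorem Connected.exists_adj_colorDist (hG : G.Connected) {c : G.Coloring (Fin k)}
    (hc : Function.Surjective c) {v : V} {i : Fin k} {n : ℕ} (h : G.colorDist c v i = n + 1) :
    ∃ u, G.Adj v u ∧ G.colorDist c u i = n := by
  obtain ⟨w, rfl, hd⟩ := exists_dist_eq_colorDist hc v i
  obtain ⟨p, hp⟩ := hG.exists_walk_length_eq_dist v w
  cases p with
  | nil => rw [h, SimpleGraph.dist_self] at hd; omega
  | cons hadj p =>
    rename_i u
    refine ⟨u, hadj, ?_⟩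
    have h1 := hG.colorDist_le_of_adj hc hadj (c w)
    have h2 := colorDist_le_dist c u w
    have h3 := dist_le p
    simp at hp
    omega

theorem Connected.colorDist_eq_one_of_adj (hG : G.Connected) {c : G.Coloring (Fin k)}
    (hc : Function.Surjective c) {u v : V} (h : G.Adj u v) : G.colorDist c u (c v) = 1 := by
  have h1 := hG.colorDist_le_of_adj hc h (c v)
  have h2 := (hG.colorDist_eq_zero_iff hc (v := v)).2 rfl
  have h3 := (hG.colorDist_eq_zero_iff hc (v := u) (i := c v)).not.2 (c.valid h)
  omega

end SimpleGraph

/-! ### Drawings, and the locating colouring of a drawing -/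

/-- Points that are joined by an edge of a rail, or by a rung, of any length and level. -/
def FigureAdj (p q : FigurePoint) : Prop :=
  ∃ i j : Fin 3, ∃ n : ℕ, i ≠ j ∧
    (s(p, q) = s(railPoint i j n, railPoint i j (n + 1)) ∨ s(p, q) = rung i j n)

theorem color_ne_of_figureAdj {p q : FigurePoint} (h : FigureAdj p q) : p.color ≠ q.color := by
  obtain ⟨i, j, n, hij, h | h⟩ := h
  · rcases Sym2.eq_iff.1 h with ⟨rfl, rfl⟩ | ⟨rfl, rfl⟩ <;>
    · by_cases hn : Even n <;> simp [color_railPoint, Nat.even_add_one, hn, hij, hij.symm]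
  · rcases Sym2.eq_iff.1 h with ⟨rfl, rfl⟩ | ⟨rfl, rfl⟩ <;>
    · by_cases hn : Even n <;> simp [color_railPoint, hn, hij, hij.symm]

theorem figureAdj_railPoint_succ {i j : Fin 3} {n : ℕ} {q : FigurePoint}
    (h : FigureAdj (railPoint i j (n + 1)) q) :
    q = railPoint i j n ∨ q = railPoint i j (n + 2) ∨ q = railPoint j i (n + 1) := by
  obtain ⟨i', j', n', hij, h | h⟩ := h
  · rcases Sym2.eq_iff.1 h with ⟨h1, rfl⟩ | ⟨h1, rfl⟩
    · obtain ⟨rfl, rfl, h | rfl⟩ := railPoint_inj.1 h1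
      · omega
      · simp
    · obtain ⟨rfl, h0, h | rfl⟩ := railPoint_inj.1 h1
      · omega
      · obtain rfl : n = n' := by omega
        simp
  · rcases Sym2.eq_iff.1 h with ⟨h1, rfl⟩ | ⟨h1, rfl⟩
    · obtain ⟨rfl, rfl, h | rfl⟩ := railPoint_inj.1 h1
      · omega
      · simp
    · obtain ⟨rfl, rfl, h | rfl⟩ := railPoint_inj.1 h1
      · omega
      · simp

/-- Without a rung at level 0, a neighbour of a given colour therefore forces a rail of positive
length; this yields the pendant paths of the bipartite figure. -/
theorem figureAdj_hub {i : Fin 3} {q : FigurePoint} (h : FigureAdj (hub i) q) :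
    q = hub q.color ∨ q = railPoint i q.color 1 := by
  obtain ⟨i', j', n', hij, h | h⟩ := h
  · rcases Sym2.eq_iff.1 h with ⟨h1, rfl⟩ | ⟨h1, rfl⟩
    · rw [← railPoint_zero i i] at h1
      obtain ⟨rfl, rfl, -⟩ := railPoint_inj.1 h1
      simp [color_railPoint]
    · rw [← railPoint_zero i i] at h1
      obtain ⟨rfl, h0, -⟩ := railPoint_inj.1 h1
      omega
  · rcases Sym2.eq_iff.1 h with ⟨h1, rfl⟩ | ⟨h1, rfl⟩ <;>
    · rw [← railPoint_zero i i] at h1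
      obtain ⟨rfl, rfl, -⟩ := railPoint_inj.1 h1
      exact Or.inl rfl

theorem figureAdj_relabel (σ : Equiv.Perm (Fin 3)) {p q : FigurePoint} (h : FigureAdj p q) :
    FigureAdj (p.relabel σ) (q.relabel σ) := by
  obtain ⟨i, j, n, hij, h⟩ := h
  refine ⟨σ i, σ j, n, σ.injective.ne hij, ?_⟩
  rcases h with h | h
  · left
    simpa [relabel_railPoint] using congrArg (Sym2.map (relabel σ)) h
  · right
    simpa [relabel_railPoint, rung] using congrArg (Sym2.map (relabel σ)) h

/-- A drawing of `G` in the points of the figures that makes the colours of the points a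
locating colouring: rails are drawn down to their hubs, and every hub that is used has
neighbours of both other colours. -/
structure IsDrawing {V : Type*} (G : SimpleGraph V) (f : V → FigurePoint) : Prop where
  injective : Function.Injective f
  adj : ∀ {u v : V}, G.Adj u v → FigureAdj (f u) (f v)
  exists_railPoint : ∀ v, ∃ i j n, i ≠ j ∧ f v = railPoint i j n
  down : ∀ {v : V} {i j : Fin 3} {n : ℕ}, f v = railPoint i j (n + 1) →
    ∃ u, G.Adj v u ∧ f u = railPoint i j n
  hub_adj : ∀ {v : V} {i : Fin 3}, f v = hub i → ∀ j, j ≠ i → ∃ u, G.Adj v u ∧ (f u).color = j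

namespace IsDrawing

variable {V : Type*} {G : SimpleGraph V} {f : V → FigurePoint}

theorem relabel (hf : IsDrawing G f) (σ : Equiv.Perm (Fin 3)) :
    IsDrawing G (fun v => (f v).relabel σ) where
  injective u v h := hf.injective <| by
    simpa [relabel_symm_relabel] using congrArg (FigurePoint.relabel σ.symm) h
  adj h := figureAdj_relabel σ (hf.adj h)
  exists_railPoint v := by
    obtain ⟨i, j, n, hij, h⟩ := hf.exists_railPoint v
    exact ⟨σ i, σ j, n, σ.injective.ne hij, by rw [h, relabel_railPoint]⟩
  down {v i j n} h := by
    have h' := congrArg (FigurePoint.relabel σ.symm) h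
    rw [relabel_symm_relabel, relabel_railPoint] at h'
    obtain ⟨u, hu, hfu⟩ := hf.down h'
    exact ⟨u, hu, by simp [hfu, relabel_railPoint]⟩
  hub_adj {v i} h j hj := by
    have h' := congrArg (FigurePoint.relabel σ.symm) h
    rw [relabel_symm_relabel] at h'
    obtain ⟨u, hu, hfu⟩ := hf.hub_adj (i := σ.symm i) h' (σ.symm j) (σ.symm.injective.ne hj)
    exact ⟨u, hu, by simp [hfu, color_relabel]⟩

/-- The colouring of `G` by the colours of the points. -/
def coloring (hf : IsDrawing G f) : G.Coloring (Fin 3) :=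
  SimpleGraph.Coloring.mk (fun v => (f v).color) fun h => color_ne_of_figureAdj (hf.adj h)

theorem coloring_apply (hf : IsDrawing G f) (v : V) : hf.coloring v = (f v).color := rfl

theorem exists_hub (hf : IsDrawing G f) {i j : Fin 3} {n : ℕ} :
    ∀ {v}, f v = railPoint i j n → ∃ u, f u = hub i := by
  induction n with
  | zero => exact fun {v} h => ⟨v, h⟩
  | succ n ih =>
    intro v h
    obtain ⟨u, -, hu⟩ := hf.down h
    exact ih hu

theorem surjective_coloring [Nonempty V] (hf : IsDrawing G f) :
    Function.Surjective hf.coloring := by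
  obtain ⟨i, j, n, hij, h⟩ := hf.exists_railPoint (Classical.arbitrary V)
  obtain ⟨v, hv⟩ := hf.exists_hub h
  intro x
  by_cases hx : x = i
  · exact ⟨v, by rw [coloring_apply, hv, hx]; rfl⟩
  · obtain ⟨u, -, hu⟩ := hf.hub_adj hv x hx
    exact ⟨u, hu⟩

/-- Both rails of the ladder between i and j carry only the colours i and j. From a positive level
every edge stays on this ladder and lowers the level by at most one, so n steps are needed to reach
a hub and one more to see the third colour. -/
theorem lt_colorDist (hf : IsDrawing G f) (hG : G.Connected) {i j : Fin 3} (hij : i ≠ j)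
    (d : ℕ) : ∀ {v : V} {i' j' : Fin 3} {n : ℕ}, (i' = i ∧ j' = j) ∨ (i' = j ∧ j' = i) →
      f v = railPoint i' j' n →
      G.colorDist hf.coloring v (thirdHub i j) = d → n < d := by
  have := hG.nonempty
  induction d with
  | zero =>
    intro v i' j' n hij' hv hd
    rw [hG.colorDist_eq_zero_iff hf.surjective_coloring, coloring_apply, hv,
      color_railPoint] at hd
    have h1 := thirdHub_ne_left hij
    have h2 := thirdHub_ne_right hij
    rcases hij' with ⟨rfl, rfl⟩ | ⟨rfl, rfl⟩ <;> split_ifs at hd <;>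
      first | exact absurd hd.symm h1 | exact absurd hd.symm h2
  | succ d ih =>
    intro v i' j' n hij' hv hd
    obtain ⟨u, hu, hd'⟩ := hG.exists_adj_colorDist hf.surjective_coloring hd
    cases n with
    | zero => omega
    | succ n =>
      have := hf.adj hu
      rw [hv] at this
      rcases figureAdj_railPoint_succ this with h | h | h
      · have := ih hij' h hd'; omega
      · have := ih hij' h hd'; omega
      · have := ih (by tauto) h hd'; omega

/-- Descending the rail bounds the third entry from above, and `lt_colorDist` bounds it from below.
At a hub both other colours are adjacent. -/
theorem isCodeAt (hf : IsDrawing G f) (hG : G.Connected) {i j : Fin 3} (hij : i ≠ j) {n : ℕ} :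
    ∀ {v : V}, f v = railPoint i j n → IsCodeAt (G.colorDist hf.coloring v) i j n := by
  have := hG.nonempty
  have hs := hf.surjective_coloring
  induction n with
  | zero =>
    intro v hv
    have key : ∀ x, x ≠ i → G.colorDist hf.coloring v x = 1 := by
      intro x hx
      obtain ⟨u, hu, rfl⟩ := hf.hub_adj hv x hx
      exact hG.colorDist_eq_one_of_adj hs hu
    refine ⟨hij, ?_, key _ hij.symm, key _ (thirdHub_ne_left hij)⟩
    rw [hG.colorDist_eq_zero_iff hs, coloring_apply, hv]
  | succ n ih =>
    intro v hv
    obtain ⟨u, hu, hfu⟩ := hf.down hv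
    have hc := ih hfu
    refine ⟨hij, ?_, ?_, ?_⟩
    · rw [hG.colorDist_eq_zero_iff hs, coloring_apply, hv]
    · have := hG.colorDist_eq_one_of_adj hs hu
      rw [coloring_apply, hfu] at this
      rw [color_railPoint_succ, this]
    · have h1 := hG.colorDist_le_of_adj hs hu (thirdHub i j)
      have h2 := hc.third
      have h3 := hf.lt_colorDist hG hij _ (Or.inl ⟨rfl, rfl⟩) hv rfl
      omega

theorem isLocating (hf : IsDrawing G f) (hG : G.Connected) : G.IsLocating hf.coloring := by
  have := hG.nonempty
  refine ⟨hf.surjective_coloring, fun u v h => hf.injective ?_⟩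
  obtain ⟨i, j, n, hij, hu⟩ := hf.exists_railPoint u
  obtain ⟨i', j', n', hij', hv⟩ := hf.exists_railPoint v
  have h1 := hf.isCodeAt hG hij hu
  have h2 := hf.isCodeAt hG hij' hv
  simp only at h
  rw [← h] at h2
  rw [hu, hv]
  exact h1.point_unique h2

end IsDrawing

/-! ### The drawing of a locating colouring -/

namespace SimpleGraph

variable {V : Type*} {G : SimpleGraph V}

theorem exists_isCodeAt (hG : G.Connected) {c : G.Coloring (Fin 3)}
    (hc : Function.Surjective c) {u v : V} (h : G.Adj u v) :
    ∃ i j n, IsCodeAt (G.colorDist c u) i j n ∧ (c v = i ∨ c v = j) := by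
  have hne := c.valid h
  have h1 := hG.colorDist_eq_one_of_adj hc h
  have h0 := (hG.colorDist_eq_zero_iff hc (v := u)).2 rfl
  have ht := (hG.colorDist_eq_zero_iff hc (v := u) (i := thirdHub (c u) (c v))).not.2
    (thirdHub_ne_left hne).symm
  obtain ⟨n, hn⟩ := Nat.exists_eq_succ_of_ne_zero ht
  -- Colours alternate along a rail, so the parity of the level decides whether the rail starts at
  -- the colour of `u` or at that of `v`.
  by_cases he : Even n
  · exact ⟨c u, c v, n, ⟨hne, by simpa [color_railPoint, he], by simpa [color_railPoint, he], hn⟩,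
      by simp⟩
  · refine ⟨c v, c u, n, ⟨hne.symm, by simpa [color_railPoint, he], by simpa [color_railPoint, he],
      ?_⟩, by simp⟩
    rw [thirdHub_comm, hn]

theorem IsLocating.exists_isDrawing (hG : G.Connected) {c : G.Coloring (Fin 3)}
    (hc : G.IsLocating c) : ∃ f, IsDrawing G f := by
  obtain ⟨hs, hinj⟩ := hc
  have hnt : Nontrivial V := hs.nontrivial
  have hex : ∀ v, ∃ p, ∃ i j n, IsCodeAt (G.colorDist c v) i j n ∧ p = railPoint i j n := by
    intro v
    obtain ⟨w, hw⟩ := hG.preconnected.exists_adj_of_nontrivial v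
    obtain ⟨i, j, n, h, -⟩ := exists_isCodeAt hG hs hw
    exact ⟨_, i, j, n, h, rfl⟩
  choose f hf using hex
  have hfeq : ∀ {v i j n}, IsCodeAt (G.colorDist c v) i j n → f v = railPoint i j n := by
    intro v i j n h
    obtain ⟨i', j', n', h', he⟩ := hf v
    rw [he, h'.point_unique h]
  have hcol : ∀ v, (f v).color = c v := by
    intro v
    obtain ⟨i, j, n, h, he⟩ := hf v
    rw [he, (hG.colorDist_eq_zero_iff hs).1 h.self]
  refine ⟨f, ⟨?_, ?_, ?_, ?_, ?_⟩⟩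
  · intro u v huv
    obtain ⟨i, j, n, h, he⟩ := hf u
    obtain ⟨i', j', n', h', he'⟩ := hf v
    exact hinj (h.code_unique h' (by rw [← he, ← he', huv]))
  · intro u v huv
    obtain ⟨i, j, n, h, hv⟩ := exists_isCodeAt hG hs huv
    have hcu := (hG.colorDist_eq_zero_iff hs).1 h.self
    have hcv : c v = (railPoint j i n).color := by
      have := c.valid huv
      rw [hcu] at this
      rw [color_railPoint] at *
      split_ifs at * <;> tauto
    have h1 := hG.colorDist_le_of_adj hs huv (thirdHub i j)
    have h2 := hG.colorDist_le_of_adj hs huv.symm (thirdHub i j)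
    have h3 := h.third
    -- The colour of `v` is i or j, so its third entry is positive; this excludes a step down from
    -- level 0.
    have h4 := (hG.colorDist_eq_zero_iff hs (v := v) (i := thirdHub i j)).not.2 (by
      have h5 := thirdHub_ne_left h.ne
      have h6 := thirdHub_ne_right h.ne
      rcases hv with hv | hv <;> rw [hv] <;> tauto)
    have h7 := hG.colorDist_eq_one_of_adj hs huv.symm
    have h8 := (hG.colorDist_eq_zero_iff hs (v := v)).2 rfl
    rw [hcu] at h7
    rw [hcv] at h8
    rw [hfeq h]
    -- The three values mean a step towards the hub, a rung, and a step away from the hub.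
    obtain hd | hd | hd : G.colorDist c v (thirdHub i j) = n ∨
        G.colorDist c v (thirdHub i j) = n + 1 ∨ G.colorDist c v (thirdHub i j) = n + 2 := by
      omega
    · obtain ⟨m, rfl⟩ := Nat.exists_eq_succ_of_ne_zero (show n ≠ 0 by omega)
      have : IsCodeAt (G.colorDist c v) i j m :=
        ⟨h.ne, by rw [← color_railPoint_succ]; exact h8,
          by rw [← color_railPoint_succ]; exact h7, hd⟩
      rw [hfeq this]
      exact ⟨i, j, m, h.ne, Or.inl Sym2.eq_swap⟩
    · have : IsCodeAt (G.colorDist c v) j i n :=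
        ⟨h.ne.symm, h8, h7, by rw [thirdHub_comm]; exact hd⟩
      rw [hfeq this]
      exact ⟨i, j, n, h.ne, Or.inr rfl⟩
    · have : IsCodeAt (G.colorDist c v) i j (n + 1) :=
        ⟨h.ne, by rw [color_railPoint_succ]; exact h8,
          by rw [color_railPoint_succ]; exact h7, hd⟩
      rw [hfeq this]
      exact ⟨i, j, n, h.ne, Or.inl rfl⟩
  · intro v
    obtain ⟨i, j, n, h, he⟩ := hf v
    exact ⟨i, j, n, h.ne, he⟩
  · intro v i j n hv
    obtain ⟨i', j', n', h, he⟩ := hf v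
    rw [hv] at he
    obtain ⟨rfl, rfl, h0 | rfl⟩ := railPoint_inj.1 he
    · omega
    -- A neighbour nearer to the third colour lies one level lower. It is on the same rail since its
    -- colour differs from that of `v` and, its entry being n + 1 > 0, is not the third one.
    obtain ⟨u, hu, hd⟩ := hG.exists_adj_colorDist hs h.third
    have h7 := hG.colorDist_eq_one_of_adj hs hu.symm
    have h8 := (hG.colorDist_eq_zero_iff hs (v := u)).2 rfl
    have hcv := (hG.colorDist_eq_zero_iff hs).1 h.self
    have hne := c.valid hu
    have hnt := (hG.colorDist_eq_zero_iff hs (v := u) (i := thirdHub i j)).not.1 (by omega)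
    refine ⟨u, hu, hfeq ⟨h.ne, ?_, ?_, hd⟩⟩
    · rw [hG.colorDist_eq_zero_iff hs]
      rw [hcv] at hne
      rw [color_railPoint] at *
      have := eq_or_eq_or_eq_thirdHub h.ne (c u)
      by_cases hn : Even n <;> simp [Nat.even_add_one, hn] at * <;> tauto
    · rw [← h7, hcv, color_railPoint_succ]
  · intro v i hv j hj
    obtain ⟨i', j', n', h, he⟩ := hf v
    rw [hv, ← railPoint_zero i i] at he
    obtain ⟨rfl, rfl, -⟩ := railPoint_inj.1 he
    have h1 : G.colorDist c v j = 0 + 1 := by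
      rcases eq_or_eq_or_eq_thirdHub h.ne j with rfl | rfl | rfl
      · exact absurd rfl hj
      · exact h.other
      · exact h.third
    obtain ⟨u, hu, hd⟩ := hG.exists_adj_colorDist hs h1
    exact ⟨u, hu, by rw [hcol, ← hG.colorDist_eq_zero_iff hs, hd]⟩

end SimpleGraph

/-! ### Reduction to a locating 3-colouring without a distinguishing 2-colouring -/

namespace SimpleGraph

variable {V : Type*} {G : SimpleGraph V}

/-- Automorphisms preserve distances, so one that preserves colours preserves codes. -/
theorem Connected.isDistinguishing_of_isLocating (hG : G.Connected) {k : ℕ}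
    {c : G.Coloring (Fin k)} (hc : G.IsLocating c) : G.IsDistinguishing c := by
  intro φ hφ v
  apply hc.2
  funext i
  simp only [colorDist]
  congr 1
  have hdist : ∀ a b, G.dist (φ a) (φ b) = G.dist a b := by
    have hle : ∀ (ψ : G ≃g G) (a b : V), G.dist (ψ a) (ψ b) ≤ G.dist a b := by
      intro ψ a b
      obtain ⟨p, hp⟩ := hG.exists_walk_length_eq_dist a b
      rw [← hp, ← Walk.length_map ψ.toHom p]
      exact dist_le _
    intro a b
    exact le_antisymm (hle φ a b) (by simpa using hle φ.symm (φ a) (φ b))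
  ext d
  constructor
  · rintro ⟨u, rfl, rfl⟩
    refine ⟨φ.symm u, ?_, ?_⟩
    · simpa using (hφ (φ.symm u)).symm
    · simpa using (hdist v (φ.symm u)).symm
  · rintro ⟨u, rfl, rfl⟩
    exact ⟨φ u, hφ u, hdist v u⟩

/-- With at most two colours, every entry at a colour other than the vertex's own is 1. The code is
thus determined by the colour, and a locating colouring is injective. -/
theorem Connected.card_le_two_of_isLocating (hG : G.Connected) {k : ℕ} (hk : k ≤ 2)
    {c : G.Coloring (Fin k)} (hc : G.IsLocating c) : Nat.card V ≤ k := by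
  rw [← Nat.card_fin k]
  refine Nat.card_le_card_of_injective c fun u v huv => hc.2 ?_
  funext i
  change G.colorDist c u i = G.colorDist c v i
  by_cases hi : c u = i
  · rw [(hG.colorDist_eq_zero_iff hc.1).2 hi, (hG.colorDist_eq_zero_iff hc.1).2 (huv ▸ hi)]
  · obtain ⟨w, hw⟩ := hc.1 i
    have hnt : Nontrivial V := ⟨u, w, fun h => hi (h ▸ hw)⟩
    have key : ∀ x, c x ≠ i → G.colorDist c x i = 1 := by
      intro x hx
      obtain ⟨y, hy⟩ := hG.preconnected.exists_adj_of_nontrivial x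
      have : c y = i := by
        have := c.valid hy
        have h1 := (c x).isLt
        have h2 := (c y).isLt
        have h3 := i.isLt
        simp only [ne_eq, Fin.ext_iff] at *
        omega
      rw [← this]
      exact hG.colorDist_eq_one_of_adj hc.1 hy
    rw [key u hi, key v (huv ▸ hi)]

theorem IsDistinguishing.exists_of_le {k l : ℕ} (h : k ≤ l) {c : G.Coloring (Fin k)}
    (hc : G.IsDistinguishing c) : ∃ c' : G.Coloring (Fin l), G.IsDistinguishing c' := by
  refine ⟨Coloring.mk (fun v => Fin.castLE h (c v)) fun huv he =>
    c.valid huv (Fin.castLE_injective h he), fun φ hφ => hc φ fun v => ?_⟩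
  exact Fin.castLE_injective h (hφ v)

theorem Connected.numbers_eq_three_iff [Finite V] (hG : G.Connected) :
    (G.distinguishingChromaticNumber = 3 ∧ G.locatingChromaticNumber = 3) ↔
      (∃ c : G.Coloring (Fin 3), G.IsLocating c) ∧
        ¬ ∃ c : G.Coloring (Fin 2), G.IsDistinguishing c := by
  constructor
  · rintro ⟨hD, hL⟩
    -- The value 3 is not the default value 0 of the infimum of the empty set, so a minimum is
    -- attained.
    have h3 := Nat.sInf_mem (s := {k : ℕ | ∃ c : G.Coloring (Fin k), G.IsLocating c})
      (Nat.nonempty_of_sInf_eq_succ hL)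
    rw [locatingChromaticNumber] at hL
    rw [hL] at h3
    refine ⟨h3, fun h2 => ?_⟩
    have : G.distinguishingChromaticNumber ≤ 2 := Nat.sInf_le h2
    omega
  · rintro ⟨⟨c, hc⟩, h2⟩
    have hcard : 3 ≤ Nat.card V := by
      simpa using Nat.card_le_card_of_surjective c hc.1
    constructor
    · refine le_antisymm (Nat.sInf_le ⟨c, hG.isDistinguishing_of_isLocating hc⟩) ?_
      refine le_csInf ⟨3, c, hG.isDistinguishing_of_isLocating hc⟩ ?_
      rintro k ⟨c', hc'⟩
      by_contra hk
      exact h2 (hc'.exists_of_le (by omega))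
    · refine le_antisymm (Nat.sInf_le ⟨c, hc⟩) (le_csInf ⟨3, c, hc⟩ ?_)
      rintro k ⟨c', hc'⟩
      by_contra hk
      have := hG.card_le_two_of_isLocating (by omega) hc'
      omega

theorem Coloring.even_length_iff_eq (c : G.Coloring (Fin 2)) {u v : V} (p : G.Walk u v) :
    Even p.length ↔ c u = c v := by
  induction p with
  | nil => simp
  | cons h p ih =>
    have := c.valid h
    rw [Walk.length_cons, Nat.even_add_one, ih]
    simp only [Fin.ext_iff, ne_eq] at *
    omega

/-- By the parity of walks, two vertices lie on the same side for one 2-colouring if and only if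
they do so for any other; hence the automorphism preserves every 2-colouring. -/
theorem HasSidePreservingAut.not_exists_isDistinguishing (hG : G.Connected)
    (h : G.HasSidePreservingAut) : ¬ ∃ c : G.Coloring (Fin 2), G.IsDistinguishing c := by
  rintro ⟨c', hc'⟩
  obtain ⟨c, φ, ⟨v, hv⟩, hφ⟩ := h
  refine hv (hc' φ (fun w => ?_) v)
  obtain ⟨p⟩ := hG.preconnected (φ w) w
  rw [← c'.even_length_iff_eq p, c.even_length_iff_eq p, hφ]

theorem hasSidePreservingAut_of_not_exists (c : G.Coloring (Fin 2))
    (h : ¬ ∃ c : G.Coloring (Fin 2), G.IsDistinguishing c) : G.HasSidePreservingAut := by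
  have := not_exists.1 h c
  simp only [IsDistinguishing, not_forall] at this
  obtain ⟨φ, hφ, v, hv⟩ := this
  exact ⟨c, φ, ⟨v, hv⟩, hφ⟩

theorem HasSidePreservingAut.of_iso {W : Type*} {H : SimpleGraph W} (e : G ≃g H)
    (h : H.HasSidePreservingAut) : G.HasSidePreservingAut := by
  obtain ⟨c, φ, ⟨v, hv⟩, hφ⟩ := h
  refine ⟨c.comp e.toHom, (e.trans φ).trans e.symm, ⟨e.symm v, ?_⟩, fun w => ?_⟩
  · simpa using hv
  · have := hφ (e w)
    simpa using this

theorem HasSidePreservingAut.two_le_card [Finite V] (h : G.HasSidePreservingAut) :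
    2 ≤ Nat.card (G ≃g G) := by
  obtain ⟨c, φ, ⟨v, hv⟩, hφ⟩ := h
  have : Finite (G ≃g G) := DFunLike.finite _
  have : Nontrivial (G ≃g G) := ⟨φ, RelIso.refl _, fun he => hv (by rw [he]; rfl)⟩
  exact Finite.one_lt_card

end SimpleGraph

/-! ### Winding of walks modulo m, and cycles from sequences -/

namespace SimpleGraph

variable {V : Type*} {G : SimpleGraph V}

/-- Here `s` is the sum of the signs of the steps, the total displacement after lifting the walk
from residues to integers. -/
theorem Walk.exists_winding {m : ℤ} {pos : V → ℤ}
    (h : ∀ u v, G.Adj u v → m ∣ pos v - pos u - 1 ∨ m ∣ pos v - pos u + 1)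
    {u v : V} (p : G.Walk u v) :
    ∃ s : ℤ, |s| ≤ p.length ∧ Even (s - p.length) ∧ m ∣ pos v - pos u - s := by
  induction p with
  | nil => exact ⟨0, by simp⟩
  | @cons u w v hadj p ih =>
    obtain ⟨s, hs, he, hd⟩ := ih
    rw [abs_le] at hs
    rcases h _ _ hadj with h1 | h1
    · refine ⟨s + 1, ?_, ?_, ?_⟩
      · rw [abs_le, length_cons]; push_cast; omega
      · rw [length_cons]; push_cast; simpa using he
      · obtain ⟨a, ha⟩ := hd
        obtain ⟨b, hb⟩ := h1
        exact ⟨a + b, by linear_combination ha + hb⟩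
    · refine ⟨s - 1, ?_, ?_, ?_⟩
      · rw [abs_le, length_cons]; push_cast; omega
      · rw [length_cons]; push_cast
        rw [show s - 1 - ((p.length : ℤ) + 1) = s - p.length - 2 by ring]
        exact he.sub even_two
      · obtain ⟨a, ha⟩ := hd
        obtain ⟨b, hb⟩ := h1
        exact ⟨a + b, by linear_combination ha + hb⟩

/-- The displacement of an odd closed walk is odd, hence a nonzero multiple of m. -/
theorem Walk.le_length_of_odd {m : ℕ} {pos : V → ℤ}
    (h : ∀ u v, G.Adj u v → (m : ℤ) ∣ pos v - pos u - 1 ∨ (m : ℤ) ∣ pos v - pos u + 1)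
    {v : V} (p : G.Walk v v) (hp : Odd p.length) : m ≤ p.length := by
  obtain ⟨s, hs, he, hd⟩ := p.exists_winding h
  have hs0 : s ≠ 0 := by
    rintro rfl
    rw [zero_sub, even_neg, Int.even_coe_nat] at he
    exact Nat.not_even_iff_odd.2 hp he
  have : (m : ℤ) ∣ |s| := by simpa using hd
  have := Int.le_of_dvd (abs_pos.2 hs0) this
  omega

theorem exists_walk_of_seq (p : ℕ → V) (n : ℕ) (h : ∀ k < n, G.Adj (p k) (p (k + 1))) :
    ∃ w : G.Walk (p 0) (p n), w.support = (List.range (n + 1)).map p ∧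
      w.edges = (List.range n).map fun k => s(p k, p (k + 1)) := by
  induction n with
  | zero => exact ⟨Walk.nil, by simp⟩
  | succ n ih =>
    obtain ⟨w, hw, he⟩ := ih fun k hk => h k (by omega)
    refine ⟨w.concat (h n (by omega)), ?_, ?_⟩
    · rw [Walk.support_concat, hw, List.range_succ (n := n + 1)]
      simp
    · rw [Walk.edges_concat, he, List.range_succ (n := n)]
      simp

theorem exists_isCycle_of_seq (p : ℕ → V) {m : ℕ} (hm : 3 ≤ m)
    (hadj : ∀ k < m, G.Adj (p k) (p (k + 1))) (hclosed : p m = p 0)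
    (hinj : Set.InjOn p (Set.Iio m)) :
    ∃ (v : V) (C : G.Walk v v), C.IsCycle ∧ C.length = m ∧
      {e | e ∈ C.edges} = {e | ∃ k < m, e = s(p k, p (k + 1))} := by
  obtain ⟨n, rfl⟩ : ∃ n, m = n + 1 := ⟨m - 1, by omega⟩
  obtain ⟨w, hw, he⟩ := exists_walk_of_seq p n fun k hk => hadj k (by omega)
  have hlast : G.Adj (p n) (p 0) := by
    rw [← hclosed]
    exact hadj n (by omega)
  refine ⟨p n, Walk.cons hlast w, ?_, ?_, ?_⟩
  · rw [Walk.cons_isCycle_iff]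
    refine ⟨Walk.IsPath.mk' ?_, ?_⟩
    · rw [hw, List.nodup_map_iff_inj_on List.nodup_range]
      intro x hx y hy hxy
      exact hinj (by simpa using hx) (by simpa using hy) hxy
    · rw [he]
      simp only [List.mem_map, List.mem_range, not_exists, not_and]
      intro k hk hek
      have inj : ∀ x y, x < n + 1 → y < n + 1 → p x = p y → x = y :=
        fun x y hx hy hxy => hinj hx hy hxy
      rcases Sym2.eq_iff.1 hek with ⟨h1, h2⟩ | ⟨h1, h2⟩
      · have := inj _ _ (by omega) (by omega) h1
        omega
      -- The closing edge could only be the first edge of the path if k = 0 and n = 1, which `hm`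
      -- excludes.
      · have h3 := inj _ _ (by omega) (by omega) h1
        have h4 := inj _ _ (by omega) (by omega) h2
        omega
  · have := congrArg List.length he
    simpa using this
  · ext e
    simp only [Walk.edges_cons, List.mem_cons, he, List.mem_map, List.mem_range,
      Set.mem_ofPred_eq]
    constructor
    · rintro (rfl | ⟨k, hk, rfl⟩)
      · exact ⟨n, by omega, by rw [hclosed]⟩
      · exact ⟨k, by omega, rfl⟩
    · rintro ⟨k, hk, rfl⟩
      by_cases hkn : k = n
      · left; rw [hkn, hclosed]
      · right; exact ⟨k, by omega, rfl⟩

end SimpleGraph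

/-! ### The blue cycle and the folding onto it -/

/-- The point at distance `n` from hub `i` on the way along the rail `(i, j)`, over the rung at
level `r`, and back along the rail `(j, i)`. -/
def bridgePoint (i j : Fin 3) (r n : ℕ) : FigurePoint :=
  if n ≤ r then railPoint i j n else railPoint j i (2 * r + 1 - n)

theorem exists_bridgePoint_edge_iff {i j : Fin 3} {r : ℕ} {e : Sym2 FigurePoint} :
    (∃ k < 2 * r + 1, e = s(bridgePoint i j r k, bridgePoint i j r (k + 1))) ↔
      (∃ n < r, e = s(railPoint i j n, railPoint i j (n + 1))) ∨
      (∃ n < r, e = s(railPoint j i n, railPoint j i (n + 1))) ∨ e = rung i j r := by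
  constructor
  · rintro ⟨k, hk, rfl⟩
    rcases lt_trichotomy k r with h | rfl | h
    · left
      exact ⟨k, h, by rw [bridgePoint, bridgePoint, if_pos h.le, if_pos (by omega)]⟩
    · right; right
      rw [bridgePoint, bridgePoint, if_pos le_rfl, if_neg (by omega), rung]
      congr 3
      omega
    · right; left
      refine ⟨2 * r - k, by omega, ?_⟩
      rw [bridgePoint, bridgePoint, if_neg (by omega), if_neg (by omega), Sym2.eq_swap,
        show 2 * r + 1 - (k + 1) = 2 * r - k by omega,
        show 2 * r + 1 - k = 2 * r - k + 1 by omega]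
  · rintro (⟨n, hn, rfl⟩ | ⟨n, hn, rfl⟩ | rfl)
    · exact ⟨n, by omega, by rw [bridgePoint, bridgePoint, if_pos hn.le, if_pos (by omega)]⟩
    · refine ⟨2 * r - n, by omega, ?_⟩
      rw [bridgePoint, bridgePoint, if_neg (by omega), if_neg (by omega), Sym2.eq_swap]
      congr 3 <;> omega
    · refine ⟨r, by omega, ?_⟩
      rw [bridgePoint, bridgePoint, if_pos le_rfl, if_neg (by omega), rung]
      congr 3
      omega

theorem ne_add_one_add_one (i : Fin 3) : i ≠ i + 1 + 1 := by revert i; decide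

theorem eq_add_one_or_eq_add_one {i j : Fin 3} (h : i ≠ j) : j = i + 1 ∨ i = j + 1 := by
  revert i j; decide

theorem ne_cases {i j : Fin 3} (h : i ≠ j) : (i = 0 ∧ j = 1) ∨ (i = 1 ∧ j = 0) ∨
    (i = 1 ∧ j = 2) ∨ (i = 2 ∧ j = 1) ∨ (i = 2 ∧ j = 0) ∨ (i = 0 ∧ j = 2) := by
  revert i j; decide

namespace NonbipartiteShape

variable (S : NonbipartiteShape)

/-- The length of the blue cycle. -/
def cycleLength : ℕ := (2 * S.low 0 1 + 1) + (2 * S.low 1 2 + 1) + (2 * S.low 2 0 + 1)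

/-- The points of the blue cycle in their order, from hub `0` on. -/
def cyclePoint (n : ℕ) : FigurePoint :=
  if n < 2 * S.low 0 1 + 1 then bridgePoint 0 1 (S.low 0 1) n
  else if n < (2 * S.low 0 1 + 1) + (2 * S.low 1 2 + 1) then
    bridgePoint 1 2 (S.low 1 2) (n - (2 * S.low 0 1 + 1))
  else bridgePoint 2 0 (S.low 2 0) (n - ((2 * S.low 0 1 + 1) + (2 * S.low 1 2 + 1)))

theorem bridgePoint_last (i j : Fin 3) (r : ℕ) : bridgePoint i j r (2 * r + 1) = hub j := by
  rw [bridgePoint, if_neg (by omega), Nat.sub_self]; rfl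

theorem bridgePoint_zero (i j : Fin 3) (r : ℕ) : bridgePoint i j r 0 = hub i := by
  rw [bridgePoint, if_pos (by omega)]; rfl

/-- The bound is not strict because consecutive bridges share a hub; so both ends of an edge can be
computed in the same bridge. -/
theorem cyclePoint_first {n : ℕ} (h : n ≤ 2 * S.low 0 1 + 1) :
    S.cyclePoint n = bridgePoint 0 1 (S.low 0 1) n := by
  rcases h.lt_or_eq with h | rfl
  · rw [cyclePoint, if_pos h]
  · rw [cyclePoint, if_neg (by omega), if_pos (by omega), Nat.sub_self, bridgePoint_last,
      bridgePoint_zero]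

theorem cyclePoint_second {n : ℕ} (h : n ≤ 2 * S.low 1 2 + 1) :
    S.cyclePoint ((2 * S.low 0 1 + 1) + n) = bridgePoint 1 2 (S.low 1 2) n := by
  rcases h.lt_or_eq with h | rfl
  · rw [cyclePoint, if_neg (by omega), if_pos (by omega), Nat.add_sub_cancel_left]
  · rw [cyclePoint, if_neg (by omega), if_neg (by omega), Nat.sub_self, bridgePoint_last,
      bridgePoint_zero]

theorem cyclePoint_third (n : ℕ) :
    S.cyclePoint ((2 * S.low 0 1 + 1) + (2 * S.low 1 2 + 1) + n) =
      bridgePoint 2 0 (S.low 2 0) n := by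
  rw [cyclePoint, if_neg (by omega), if_neg (by omega), Nat.add_sub_cancel_left]

theorem exists_cyclePoint_edge_iff {e : Sym2 FigurePoint} :
    (∃ k < S.cycleLength, e = s(S.cyclePoint k, S.cyclePoint (k + 1))) ↔
      (∃ k < 2 * S.low 0 1 + 1,
        e = s(bridgePoint 0 1 (S.low 0 1) k, bridgePoint 0 1 (S.low 0 1) (k + 1))) ∨
      (∃ k < 2 * S.low 1 2 + 1,
        e = s(bridgePoint 1 2 (S.low 1 2) k, bridgePoint 1 2 (S.low 1 2) (k + 1))) ∨
      (∃ k < 2 * S.low 2 0 + 1,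
        e = s(bridgePoint 2 0 (S.low 2 0) k, bridgePoint 2 0 (S.low 2 0) (k + 1))) := by
  constructor
  · rintro ⟨k, hk, rfl⟩
    rw [cycleLength] at hk
    by_cases h1 : k < 2 * S.low 0 1 + 1
    · left
      exact ⟨k, h1, by rw [S.cyclePoint_first h1.le, S.cyclePoint_first h1]⟩
    obtain ⟨l, rfl⟩ := Nat.exists_eq_add_of_le (not_lt.1 h1)
    by_cases h2 : l < 2 * S.low 1 2 + 1
    · right; left
      refine ⟨l, h2, ?_⟩
      rw [S.cyclePoint_second h2.le, add_assoc, S.cyclePoint_second h2]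
    obtain ⟨l, rfl⟩ := Nat.exists_eq_add_of_le (not_lt.1 h2)
    right; right
    refine ⟨l, by omega, ?_⟩
    rw [← add_assoc, S.cyclePoint_third, add_assoc, S.cyclePoint_third]
  · rintro (⟨k, hk, rfl⟩ | ⟨k, hk, rfl⟩ | ⟨k, hk, rfl⟩)
    · exact ⟨k, by rw [cycleLength]; omega,
        by rw [S.cyclePoint_first hk.le, S.cyclePoint_first hk]⟩
    · refine ⟨(2 * S.low 0 1 + 1) + k, by rw [cycleLength]; omega, ?_⟩
      rw [S.cyclePoint_second hk.le, add_assoc, S.cyclePoint_second hk]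
    · refine ⟨(2 * S.low 0 1 + 1) + (2 * S.low 1 2 + 1) + k, by rw [cycleLength]; omega, ?_⟩
      rw [S.cyclePoint_third, add_assoc _ k, S.cyclePoint_third]

theorem cyclePoint_edges :
    {e | ∃ k < S.cycleLength, e = s(S.cyclePoint k, S.cyclePoint (k + 1))} =
      S.blueCycleEdges := by
  ext e
  rw [Set.mem_ofPred_eq, exists_cyclePoint_edge_iff]
  simp only [exists_bridgePoint_edge_iff]
  have h1 : S.low 1 0 = S.low 0 1 := S.low_symm _ _
  have h2 : S.low 2 1 = S.low 1 2 := S.low_symm _ _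
  have h3 : S.low 0 2 = S.low 2 0 := S.low_symm _ _
  have hr : ∀ i j n, rung i j n = rung j i n := fun i j n => Sym2.eq_swap
  constructor
  · rintro ((⟨n, hn, rfl⟩ | ⟨n, hn, rfl⟩ | rfl) | (⟨n, hn, rfl⟩ | ⟨n, hn, rfl⟩ | rfl) |
      (⟨n, hn, rfl⟩ | ⟨n, hn, rfl⟩ | rfl))
    · exact Or.inl ⟨0, 1, n, by decide, hn, rfl⟩
    · exact Or.inl ⟨1, 0, n, by decide, h1 ▸ hn, rfl⟩
    · exact Or.inr ⟨0, 1, by decide, rfl⟩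
    · exact Or.inl ⟨1, 2, n, by decide, hn, rfl⟩
    · exact Or.inl ⟨2, 1, n, by decide, h2 ▸ hn, rfl⟩
    · exact Or.inr ⟨1, 2, by decide, rfl⟩
    · exact Or.inl ⟨2, 0, n, by decide, hn, rfl⟩
    · exact Or.inl ⟨0, 2, n, by decide, h3 ▸ hn, rfl⟩
    · exact Or.inr ⟨2, 0, by decide, rfl⟩
  · rintro (⟨i, j, n, hij, hn, rfl⟩ | ⟨i, j, hij, rfl⟩)
    · rcases ne_cases hij with ⟨rfl, rfl⟩ | ⟨rfl, rfl⟩ | ⟨rfl, rfl⟩ | ⟨rfl, rfl⟩ | ⟨rfl, rfl⟩ |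
        ⟨rfl, rfl⟩
      · exact Or.inl (Or.inl ⟨n, hn, rfl⟩)
      · exact Or.inl (Or.inr (Or.inl ⟨n, h1 ▸ hn, rfl⟩))
      · exact Or.inr (Or.inl (Or.inl ⟨n, hn, rfl⟩))
      · exact Or.inr (Or.inl (Or.inr (Or.inl ⟨n, h2 ▸ hn, rfl⟩)))
      · exact Or.inr (Or.inr (Or.inl ⟨n, hn, rfl⟩))
      · exact Or.inr (Or.inr (Or.inr (Or.inl ⟨n, h3 ▸ hn, rfl⟩)))
    · rcases ne_cases hij with ⟨rfl, rfl⟩ | ⟨rfl, rfl⟩ | ⟨rfl, rfl⟩ | ⟨rfl, rfl⟩ | ⟨rfl, rfl⟩ |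
        ⟨rfl, rfl⟩
      · exact Or.inl (Or.inr (Or.inr rfl))
      · exact Or.inl (Or.inr (Or.inr (by rw [h1, hr])))
      · exact Or.inr (Or.inl (Or.inr (Or.inr rfl)))
      · exact Or.inr (Or.inl (Or.inr (Or.inr (by rw [h2, hr]))))
      · exact Or.inr (Or.inr (Or.inr (Or.inr rfl)))
      · exact Or.inr (Or.inr (Or.inr (Or.inr (by rw [h3, hr]))))

/-- The level at which the point at level `n` of a rail lands when the ladder is folded onto its
lowest rung at level `r`, up to the side of the ladder. -/
def foldLevel (r n : ℕ) : ℕ := if n ≤ r then n else r + (n - r) % 2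

/-- The position of a hub on the blue cycle. -/
def hubPosition : Fin 3 → ℤ
  | 0 => 0
  | 1 => 2 * S.low 0 1 + 1
  | 2 => 2 * S.low 0 1 + 1 + (2 * S.low 1 2 + 1)

/-- The position on the blue cycle, modulo its length, of the image of the point at level `n` of
the rail `(i, j)` when the figure is folded onto the blue cycle. -/
def railPosition (i j : Fin 3) (n : ℕ) : ℤ :=
  S.hubPosition i + (if j = i + 1 then 1 else -1) * foldLevel (S.low i j) n

/-- The position of the image of a point under the folding. -/
def position : FigurePoint → ℤ
  | hub i => S.hubPosition i
  | FigurePoint.inner i j n => S.railPosition i j (n + 1)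

theorem position_railPoint (i j : Fin 3) (n : ℕ) :
    S.position (railPoint i j n) = S.railPosition i j n := by
  cases n with
  | zero => simp [railPoint, position, railPosition, foldLevel]
  | succ n => rfl

theorem foldLevel_succ (r n : ℕ) :
    (foldLevel r (n + 1) : ℤ) = foldLevel r n + 1 ∨
      (foldLevel r (n + 1) : ℤ) = foldLevel r n - 1 := by
  simp only [foldLevel]
  split_ifs <;> omega

theorem foldLevel_of_le {r n : ℕ} (h : r ≤ n) :
    (foldLevel r n : ℤ) = r ∨ (foldLevel r n : ℤ) = r + 1 := by
  simp only [foldLevel]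
  split_ifs <;> omega

theorem railPosition_succ (i j : Fin 3) (n : ℕ) :
    S.railPosition i j (n + 1) - S.railPosition i j n = 1 ∨
      S.railPosition i j (n + 1) - S.railPosition i j n = -1 := by
  simp only [railPosition]
  rcases foldLevel_succ (S.low i j) n with h | h <;> rw [h] <;> split_ifs <;> omega

/-- Both ends of the rung fold to the same level h, which is r or r + 1, counted from the two ends
of a bridge of length 2r + 1. Their positions differ by 2r + 1 - 2h = ±1. -/
theorem railPosition_rung_succ (i : Fin 3) {n : ℕ} (h : S.low i (i + 1) ≤ n) :
    (S.cycleLength : ℤ) ∣ S.railPosition (i + 1) i n - S.railPosition i (i + 1) n - 1 ∨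
      (S.cycleLength : ℤ) ∣ S.railPosition (i + 1) i n - S.railPosition i (i + 1) n + 1 := by
  have hs : S.low (i + 1) i = S.low i (i + 1) := S.low_symm _ _
  have hne := ne_add_one_add_one i
  simp only [railPosition, if_neg hne, hs, if_true]
  have hb : (S.cycleLength : ℤ) ∣
      S.hubPosition (i + 1) - S.hubPosition i - (2 * S.low i (i + 1) + 1) := by
    fin_cases i
    · simp [hubPosition]
    · simp [hubPosition]
    -- The bridge from hub 2 to hub 0 closes the cycle, so the positions drop by one full length.
    · refine ⟨-1, ?_⟩
      simp [hubPosition, cycleLength]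
      ring
  obtain ⟨a, ha⟩ := hb
  rcases foldLevel_of_le h with h1 | h1 <;> rw [h1]
  · left; exact ⟨a, by linear_combination ha⟩
  · right; exact ⟨a, by linear_combination ha⟩

theorem position_adj {p q : FigurePoint} (h : S.figure.Adj p q) :
    (S.cycleLength : ℤ) ∣ S.position q - S.position p - 1 ∨
      (S.cycleLength : ℤ) ∣ S.position q - S.position p + 1 := by
  have hswap : ∀ {x y : ℤ}, ((S.cycleLength : ℤ) ∣ x - y - 1 ∨ (S.cycleLength : ℤ) ∣ x - y + 1) →
      ((S.cycleLength : ℤ) ∣ y - x - 1 ∨ (S.cycleLength : ℤ) ∣ y - x + 1) := by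
    rintro x y (⟨a, ha⟩ | ⟨a, ha⟩)
    · right; exact ⟨-a, by linear_combination -ha⟩
    · left; exact ⟨-a, by linear_combination -ha⟩
  have hrail : ∀ i j n,
      (S.cycleLength : ℤ) ∣ S.railPosition i j (n + 1) - S.railPosition i j n - 1 ∨
      (S.cycleLength : ℤ) ∣ S.railPosition i j (n + 1) - S.railPosition i j n + 1 := by
    intro i j n
    rcases S.railPosition_succ i j n with h | h <;> rw [h] <;> simp
  have hrung : ∀ i j n, i ≠ j → S.low i j ≤ n →
      ((S.cycleLength : ℤ) ∣ S.railPosition j i n - S.railPosition i j n - 1 ∨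
      (S.cycleLength : ℤ) ∣ S.railPosition j i n - S.railPosition i j n + 1) := by
    intro i j n hij hn
    rcases eq_add_one_or_eq_add_one hij with rfl | rfl
    · exact S.railPosition_rung_succ i hn
    · exact hswap (S.railPosition_rung_succ j (S.low_symm _ _ ▸ hn))
  rw [figure, SimpleGraph.fromEdgeSet_adj] at h
  rcases h.1 with ⟨i, j, n, hij, hn, he⟩ | ⟨i, j, n, hij, hn, -, -, he⟩
  · rcases Sym2.eq_iff.1 he with ⟨rfl, rfl⟩ | ⟨rfl, rfl⟩ <;> simp only [position_railPoint]
    · exact hrail i j n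
    · exact hswap (hrail i j n)
  · rcases Sym2.eq_iff.1 he with ⟨rfl, rfl⟩ | ⟨rfl, rfl⟩ <;> simp only [position_railPoint]
    · exact hrung i j n hij hn
    · exact hswap (hrung i j n hij hn)

/-- The folding fixes the blue cycle; this makes the points of the cycle distinct. -/
theorem position_bridgePoint {i j : Fin 3} (h : j = i + 1) {n : ℕ} (hn : n ≤ 2 * S.low i j + 1) :
    (S.cycleLength : ℤ) ∣ S.position (bridgePoint i j (S.low i j) n) - (S.hubPosition i + n) := by
  subst h
  have hs : S.low (i + 1) i = S.low i (i + 1) := S.low_symm _ _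
  have hne := ne_add_one_add_one i
  rw [bridgePoint]
  split_ifs with h
  · rw [position_railPoint, railPosition, foldLevel, if_pos h, if_pos rfl]
    simp
  · rw [position_railPoint, railPosition, if_neg hne, hs, foldLevel, if_pos (by omega)]
    have : ((2 * S.low i (i + 1) + 1 - n : ℕ) : ℤ) = 2 * S.low i (i + 1) + 1 - n := by omega
    rw [this]
    fin_cases i
    · simp [hubPosition]
    · simp [hubPosition]
    · refine ⟨-1, ?_⟩
      simp [hubPosition, cycleLength]
      ring

theorem position_cyclePoint {n : ℕ} (hn : n < S.cycleLength) :
    (S.cycleLength : ℤ) ∣ S.position (S.cyclePoint n) - n := by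
  rw [cycleLength] at hn
  by_cases h1 : n < 2 * S.low 0 1 + 1
  · rw [S.cyclePoint_first h1.le]
    simpa [hubPosition] using S.position_bridgePoint (i := 0) (j := 1) rfl h1.le
  obtain ⟨l, rfl⟩ := Nat.exists_eq_add_of_le (not_lt.1 h1)
  by_cases h2 : l < 2 * S.low 1 2 + 1
  · rw [S.cyclePoint_second h2.le]
    simpa [hubPosition] using S.position_bridgePoint (i := 1) (j := 2) rfl h2.le
  obtain ⟨l, rfl⟩ := Nat.exists_eq_add_of_le (not_lt.1 h2)
  rw [← add_assoc, S.cyclePoint_third]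
  simpa [hubPosition] using S.position_bridgePoint (i := 2) (j := 0) (n := l) rfl (by omega)

theorem injOn_cyclePoint : Set.InjOn S.cyclePoint (Set.Iio S.cycleLength) := by
  intro x hx y hy hxy
  have h1 := S.position_cyclePoint hx
  have h2 := S.position_cyclePoint hy
  rw [hxy] at h1
  have h3 : (S.cycleLength : ℤ) ∣ x - y := by
    simpa using dvd_sub h2 h1
  rw [Set.mem_Iio] at hx hy
  have := Int.eq_zero_of_abs_lt_dvd h3 (by rw [abs_lt]; omega)
  omega

theorem odd_cycleLength : Odd S.cycleLength := by
  rw [cycleLength]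
  exact ⟨S.low 0 1 + S.low 1 2 + S.low 2 0 + 1, by ring⟩

/-- In a graph between the blue cycle and the figure, the blue cycle is a smallest odd cycle. -/
theorem isSmallestOddCycle {H : SimpleGraph FigurePoint} (hle : H ≤ S.figure)
    (hb : S.blueCycleEdges ⊆ H.edgeSet) : H.IsSmallestOddCycle S.blueCycleEdges := by
  have hE := S.cyclePoint_edges
  obtain ⟨v, C, hC, hlen, hedges⟩ := SimpleGraph.exists_isCycle_of_seq (G := H) S.cyclePoint
    (m := S.cycleLength) (by rw [cycleLength]; omega)
    (fun k hk => by
      rw [← SimpleGraph.mem_edgeSet]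
      exact hb (hE ▸ ⟨k, hk, rfl⟩))
    (by
      have h0 : S.cyclePoint 0 = hub 0 := by rw [S.cyclePoint_first (by omega), bridgePoint_zero]
      rw [h0, cycleLength, S.cyclePoint_third, bridgePoint_last])
    S.injOn_cyclePoint
  refine ⟨v, C, hC, hlen ▸ S.odd_cycleLength, hedges.trans hE, fun w C' _ hodd => ?_⟩
  rw [hlen]
  -- Positions modulo m are a homomorphism to C_m, so the bound holds for any odd closed walk.
  exact C'.le_length_of_odd (pos := S.position) (fun a b hab => S.position_adj (hle hab)) hodd

end NonbipartiteShape

/-! ### Members of the figures are drawings -/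

/-- The endpoints of a rail edge or of a rung lie on rails of sufficient length. -/
def InFigure (len : Fin 3 → Fin 3 → ℕ) (e : Sym2 FigurePoint) : Prop :=
  e ∈ railEdges len ∨ ∃ i j n, i ≠ j ∧ n ≤ len i j ∧ n ≤ len j i ∧ e = rung i j n

theorem InFigure.exists_railPoint {len : Fin 3 → Fin 3 → ℕ} {p q : FigurePoint}
    (h : InFigure len s(p, q)) : ∃ i j n, i ≠ j ∧ n ≤ len i j ∧ p = railPoint i j n := by
  rcases h with ⟨i, j, n, hij, hn, he⟩ | ⟨i, j, n, hij, hn, hn', he⟩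
  · rcases Sym2.eq_iff.1 he with ⟨rfl, rfl⟩ | ⟨rfl, rfl⟩
    · exact ⟨i, j, n, hij, hn.le, rfl⟩
    · exact ⟨i, j, n + 1, hij, hn, rfl⟩
  · rcases Sym2.eq_iff.1 he with ⟨rfl, rfl⟩ | ⟨rfl, rfl⟩
    · exact ⟨i, j, n, hij, hn, rfl⟩
    · exact ⟨j, i, n, hij.symm, hn', rfl⟩

theorem InFigure.figureAdj {len : Fin 3 → Fin 3 → ℕ} {p q : FigurePoint}
    (h : InFigure len s(p, q)) : FigureAdj p q := by
  rcases h with ⟨i, j, n, hij, hn, he⟩ | ⟨i, j, n, hij, hn, hn', he⟩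
  · exact ⟨i, j, n, hij, Or.inl he⟩
  · exact ⟨i, j, n, hij, Or.inr he⟩

/-- A connected subgraph of a figure that contains all rails is drawn by its inclusion, provided
that its hubs have neighbours of both other colours. -/
theorem isDrawing_of_iso {V : Type*} {G : SimpleGraph V} (hG : G.Connected)
    {F : SimpleGraph FigurePoint} {H : F.Subgraph} (e : G ≃g H.coe)
    {len : Fin 3 → Fin 3 → ℕ} (hF : ∀ p q, F.Adj p q → InFigure len s(p, q))
    (hrail : railEdges len ⊆ H.edgeSet) (hne : ∃ p q, H.Adj p q)
    (hhub : ∀ i p, H.Adj (hub i) p → ∀ j, j ≠ i → ∃ q, H.Adj (hub i) q ∧ q.color = j) :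
    IsDrawing G (fun v => (e v : FigurePoint)) := by
  have hadj : ∀ u v, G.Adj u v → H.Adj (e u) (e v) := fun u v h => e.map_adj_iff.2 h
  have hlift : ∀ v q, H.Adj (e v) q → ∃ u, G.Adj v u ∧ (e u : FigurePoint) = q := by
    intro v q hq
    refine ⟨e.symm ⟨q, hq.snd_mem⟩, ?_, by simp⟩
    rw [← e.map_adj_iff]
    simpa using hq
  -- A subgraph may have isolated vertices anywhere. Connectedness with at least two vertices gives
  -- every vertex an edge, which puts it on a rail within its length.
  have hnt : Nontrivial V := by
    obtain ⟨p, q, hpq⟩ := hne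
    refine ⟨e.symm ⟨p, hpq.fst_mem⟩, e.symm ⟨q, hpq.snd_mem⟩, fun h => ?_⟩
    exact hpq.ne (congrArg Subtype.val (e.symm.injective h))
  have hex : ∀ v, ∃ i j n, i ≠ j ∧ n ≤ len i j ∧ (e v : FigurePoint) = railPoint i j n := by
    intro v
    obtain ⟨w, hw⟩ := hG.preconnected.exists_adj_of_nontrivial v
    exact (hF _ _ (H.adj_sub (hadj v w hw))).exists_railPoint
  refine ⟨fun u v h => e.injective (Subtype.ext h), 
    fun h => (hF _ _ (H.adj_sub (hadj _ _ h))).figureAdj, fun v => ?_, fun {v i j n} h => ?_, fun {v i} h j hj => ?_⟩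
  · obtain ⟨i, j, n, hij, -, h⟩ := hex v
    exact ⟨i, j, n, hij, h⟩
  · obtain ⟨i', j', n', hij, hn, h'⟩ := hex v
    rw [h] at h'
    obtain ⟨rfl, rfl, h0 | rfl⟩ := railPoint_inj.1 h'
    · omega
    apply hlift
    rw [h]
    exact (SimpleGraph.Subgraph.mem_edgeSet.1 (hrail ⟨i, j, n, hij, by omega, rfl⟩)).symm
  · obtain ⟨w, hw⟩ := hG.preconnected.exists_adj_of_nontrivial v
    have hw' := hadj v w hw
    rw [h] at hw'
    obtain ⟨q, hq, hc⟩ := hhub i _ hw' j hj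
    rw [← h] at hq
    obtain ⟨u, hu, rfl⟩ := hlift v q hq
    exact ⟨u, hu, hc⟩

/-- If the edges of a ladder up to its lowest rung are present, then its hub `i` has a neighbour of
colour `j`. -/
theorem exists_adj_hub_of_ladder {F : SimpleGraph FigurePoint} {H : F.Subgraph}
    {len : Fin 3 → Fin 3 → ℕ} (hrail : railEdges len ⊆ H.edgeSet) {i j : Fin 3} (hij : i ≠ j)
    (h : 0 < len i j ∨ rung i j 0 ∈ H.edgeSet) : ∃ q, H.Adj (hub i) q ∧ q.color = j := by
  rcases h with h | h
  · refine ⟨railPoint i j 1, ?_, by simp [color_railPoint]⟩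
    exact SimpleGraph.Subgraph.mem_edgeSet.1 (hrail ⟨i, j, 0, hij, h, rfl⟩)
  · exact ⟨hub j, SimpleGraph.Subgraph.mem_edgeSet.1 h, rfl⟩

theorem rung_comm (i j : Fin 3) (n : ℕ) : rung i j n = rung j i n := Sym2.eq_swap

namespace NonbipartiteShape

variable {S : NonbipartiteShape}

theorem inFigure {p q : FigurePoint} (h : S.figure.Adj p q) : InFigure S.len s(p, q) := by
  rw [figure, SimpleGraph.fromEdgeSet_adj] at h
  rcases h.1 with h | ⟨i, j, n, hij, -, h1, h2, he⟩
  · exact Or.inl h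
  · exact Or.inr ⟨i, j, n, hij, h1, h2, he⟩

/-- A hub sees the other colour of a ladder across the lowest rung if this has level 0, and
otherwise along its rail. -/
theorem IsMember.isDrawing {V : Type*} {G : SimpleGraph V} (hG : G.Connected)
    {H : S.figure.Subgraph} (hH : S.IsMember H) (e : G ≃g H.coe) :
    IsDrawing G (fun v => (e v : FigurePoint)) := by
  obtain ⟨hrail, hblue, -⟩ := hH
  have hrung : ∀ i j, i ≠ j → rung i j (S.low i j) ∈ H.edgeSet :=
    fun i j hij => hblue (Or.inr ⟨i, j, hij, rfl⟩)
  refine isDrawing_of_iso hG e (fun p q => inFigure) hrail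
    ⟨_, _, SimpleGraph.Subgraph.mem_edgeSet.1 (hrung 0 1 (by decide))⟩ fun i p _ j hj => ?_
  refine exists_adj_hub_of_ladder hrail hj.symm ?_
  rcases Nat.eq_zero_or_pos (S.low i j) with h | h
  · right; rw [← h]; exact hrung i j hj.symm
  · left; exact h.trans_le (S.low_le i j hj.symm)

theorem IsMember.not_colorable {V : Type*} {G : SimpleGraph V}
    {H : S.figure.Subgraph} (hH : S.IsMember H) (e : G ≃g H.coe) :
    IsEmpty (G.Coloring (Fin 2)) := by
  refine ⟨fun c => ?_⟩
  obtain ⟨-, -, v, C, hC, hodd, -⟩ := hH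
  classical
  let c' : H.spanningCoe.Coloring (Fin 2) := SimpleGraph.Coloring.mk
    -- The default colour 0 outside `H` is harmless, as no edge ends there.
    (fun p => if hp : p ∈ H.verts then c (e.symm ⟨p, hp⟩) else 0) (by
      intro p q hpq
      have hpq' : H.Adj p q := hpq
      rw [dif_pos hpq'.fst_mem, dif_pos hpq'.snd_mem]
      apply c.valid
      rw [e.symm.map_adj_iff]
      exact hpq')
  exact Nat.not_even_iff_odd.2 hodd ((c'.even_length_iff_eq C).2 rfl)

end NonbipartiteShape

namespace BipartiteShape

variable {S : BipartiteShape}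

theorem inFigure {p q : FigurePoint} (h : S.figure.Adj p q) : InFigure S.len s(p, q) := by
  rw [figure, SimpleGraph.fromEdgeSet_adj] at h
  rcases h.1 with h | ⟨i, n, hi, -, -, h1, h2, he⟩
  · exact Or.inl h
  · exact Or.inr ⟨0, i, n, hi.symm, h1, h2, he⟩

theorem hasLadder_of_adj {i : Fin 3} (hi : i ≠ 0) {p : FigurePoint}
    (h : S.figure.Adj (hub i) p) : S.hasLadder i := by
  by_contra hl
  rw [figure, SimpleGraph.fromEdgeSet_adj] at h
  rcases h.1 with ⟨i', j', n, hij, hn, he⟩ | ⟨j, n, hj, hjl, -, -, -, he⟩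
  · rcases Sym2.eq_iff.1 he with ⟨h1, -⟩ | ⟨h1, -⟩ <;> rw [← railPoint_zero i i] at h1 <;>
      obtain ⟨rfl, h0, -⟩ := railPoint_inj.1 h1
    · have := S.no_rail i j' hi hij hl
      omega
    · omega
  · rcases Sym2.eq_iff.1 he with ⟨h1, -⟩ | ⟨h1, -⟩ <;> rw [← railPoint_zero i i] at h1 <;>
      obtain ⟨rfl, h0, -⟩ := railPoint_inj.1 h1
    · exact hi rfl
    · exact hl hjl

theorem IsMember.isDrawing {V : Type*} {G : SimpleGraph V} (hG : G.Connected)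
    {H : S.figure.Subgraph} (hH : S.IsMember H) (e : G ≃g H.coe) :
    IsDrawing G (fun v => (e v : FigurePoint)) := by
  have hrail : railEdges S.len ⊆ H.edgeSet := fun e he => hH (Or.inl he)
  have hladder : ∀ i, i ≠ 0 → S.hasLadder i →
      (0 < S.len 0 i ∨ rung 0 i 0 ∈ H.edgeSet) ∧ (0 < S.len i 0 ∨ rung i 0 0 ∈ H.edgeSet) := by
    intro i hi hl
    have hr : rung 0 i (S.low i) ∈ H.edgeSet := hH (Or.inr ⟨i, hi, hl, rfl⟩)
    have hle := S.low_le i hi hl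
    rw [rung_comm i 0]
    rcases Nat.eq_zero_or_pos (S.low i) with h | h
    · rw [h] at hr; exact ⟨Or.inr hr, Or.inr hr⟩
    · exact ⟨Or.inl (h.trans_le hle.1), Or.inl (h.trans_le hle.2)⟩
  have hzero : ∀ j, j ≠ 0 → 0 < S.len 0 j ∨ rung 0 j 0 ∈ H.edgeSet := by
    intro j hj
    by_cases hl : S.hasLadder j
    · exact (hladder j hj hl).1
    · exact Or.inl (S.path_pos j hj hl)
  refine isDrawing_of_iso hG e (fun p q => inFigure) hrail ?_ fun i p hp j hj => ?_
  · obtain ⟨q, hq, -⟩ := exists_adj_hub_of_ladder hrail (i := 0) (j := 1) (by decide)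
      (hzero 1 (by decide))
    exact ⟨_, _, hq⟩
  · refine exists_adj_hub_of_ladder hrail hj.symm ?_
    by_cases hi : i = 0
    · subst hi
      exact hzero j hj
    · have hl := hasLadder_of_adj hi (H.adj_sub hp)
      by_cases hj0 : j = 0
      · subst hj0
        exact (hladder i hi hl).2
      · exact Or.inl (S.tail_pos i j hi hj0 hj.symm hl)

/-- The side of a point in the bipartition of the bipartite figure. -/
def side : FigurePoint → Fin 2
  | hub i => if i = 0 then 0 else 1
  | FigurePoint.inner i _ n => if (i = 0 ↔ Odd n) then 0 else 1

theorem side_railPoint (i j : Fin 3) (n : ℕ) :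
    side (railPoint i j n) = if (i = 0 ↔ Even n) then 0 else 1 := by
  cases n with
  | zero => simp [railPoint, side]
  | succ n => simp [railPoint, side, Nat.even_add_one]

/-- The side is the parity of the level, flipped on the rails of hub 0. A rail edge changes the
level by one; a rung keeps the level and has exactly one end on a rail of hub 0. -/
theorem side_ne {p q : FigurePoint} (h : S.figure.Adj p q) : side p ≠ side q := by
  rw [figure, SimpleGraph.fromEdgeSet_adj] at h
  rcases h.1 with ⟨i, j, n, hij, hn, he⟩ | ⟨i, n, hi, -, -, h1, h2, he⟩
  · rcases Sym2.eq_iff.1 he with ⟨rfl, rfl⟩ | ⟨rfl, rfl⟩ <;>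
    · rw [side_railPoint, side_railPoint]
      by_cases hn : Even n <;> by_cases hi : i = 0 <;> simp [Nat.even_add_one, hn, hi]
  · rcases Sym2.eq_iff.1 he with ⟨rfl, rfl⟩ | ⟨rfl, rfl⟩ <;>
    · rw [side_railPoint, side_railPoint]
      by_cases hn : Even n <;> simp [hn, hi]

/-- The bipartition of the bipartite figure. -/
def sideColoring (S : BipartiteShape) : S.figure.Coloring (Fin 2) :=
  SimpleGraph.Coloring.mk side side_ne

end BipartiteShape

/-! ### The shape of a drawing -/

/-- The image of `G` in a graph on the points of the figures. -/
def imageSubgraph {V : Type*} (G : SimpleGraph V) (f : V → FigurePoint)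
    (F : SimpleGraph FigurePoint) (hF : ∀ u v, G.Adj u v → F.Adj (f u) (f v)) : F.Subgraph where
  verts := Set.range f
  Adj p q := ∃ u v, G.Adj u v ∧ f u = p ∧ f v = q
  adj_sub := by
    rintro p q ⟨u, v, h, rfl, rfl⟩
    exact hF u v h
  edge_vert := by
    rintro p q ⟨u, v, h, rfl, rfl⟩
    exact ⟨u, rfl⟩
  symm := ⟨by
    rintro p q ⟨u, v, h, rfl, rfl⟩
    exact ⟨v, u, h.symm, rfl, rfl⟩⟩

/-- A graph is isomorphic to its image. -/
noncomputable def isoImageSubgraph {V : Type*} {G : SimpleGraph V} {f : V → FigurePoint}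
    (hf : Function.Injective f) {F : SimpleGraph FigurePoint}
    (hF : ∀ u v, G.Adj u v → F.Adj (f u) (f v)) : G ≃g (imageSubgraph G f F hF).coe where
  toEquiv := Equiv.ofInjective f hf
  map_rel_iff' := by
    intro u v
    constructor
    · rintro ⟨u', v', h, hu, hv⟩
      rwa [← hf hu, ← hf hv]
    · intro h
      exact ⟨u, v, h, rfl, rfl⟩

/-- The number of edges of the rail `(i, j)` in a drawing. -/
noncomputable def railLength {V : Type*} (f : V → FigurePoint) (i j : Fin 3) : ℕ :=
  sSup {n | ∃ v, f v = railPoint i j n}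

/-- A drawing of `G` has a rung at level `n` of the ladder between `i` and `j`. -/
def HasRung {V : Type*} (G : SimpleGraph V) (f : V → FigurePoint) (i j : Fin 3) (n : ℕ) : Prop :=
  ∃ u v, G.Adj u v ∧ f u = railPoint i j n ∧ f v = railPoint j i n

theorem hasRung_comm {V : Type*} {G : SimpleGraph V} {f : V → FigurePoint} {i j : Fin 3} {n : ℕ} :
    HasRung G f i j n ↔ HasRung G f j i n :=
  ⟨fun ⟨u, v, h, hu, hv⟩ => ⟨v, u, h.symm, hv, hu⟩,
    fun ⟨u, v, h, hu, hv⟩ => ⟨v, u, h.symm, hv, hu⟩⟩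

theorem hasRung_of_eq {V : Type*} {G : SimpleGraph V} {f : V → FigurePoint} {i j : Fin 3} {n : ℕ}
    {u v : V} (h : G.Adj u v) (he : s(f u, f v) = rung i j n) : HasRung G f i j n := by
  rcases Sym2.eq_iff.1 he with ⟨h1, h2⟩ | ⟨h1, h2⟩
  · exact ⟨u, v, h, h1, h2⟩
  · exact ⟨v, u, h.symm, h2, h1⟩

/-- Finiteness bounds the levels; for unbounded levels the supremum would default to 0. -/
theorem le_railLength {V : Type*} [Finite V] {f : V → FigurePoint} {v : V} {i j : Fin 3} {n : ℕ}
    (h : f v = railPoint i j n) : n ≤ railLength f i j := by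
  refine le_csSup (Set.Finite.bddAbove ?_) ⟨v, h⟩
  have hinj : Function.Injective (railPoint i j) := fun a b hab => (railPoint_inj.1 hab).2.1
  exact ((Set.finite_range f).preimage hinj.injOn).subset fun n ⟨v, hv⟩ => ⟨v, hv⟩

namespace IsDrawing

variable {V : Type*} {G : SimpleGraph V} {f : V → FigurePoint}

/-- Descend from the highest point of the rail, which exists because the supremum is positive and
hence attained. -/
theorem exists_rail_edge [Finite V] (hf : IsDrawing G f) {i j : Fin 3} {n : ℕ}
    (h : n < railLength f i j) :
    ∃ u v, G.Adj u v ∧ f u = railPoint i j n ∧ f v = railPoint i j (n + 1) := by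
  have hne : {n | ∃ v, f v = railPoint i j n}.Nonempty := by
    rw [Set.nonempty_iff_ne_empty]
    intro he
    simp [railLength, he] at h
  have hbdd : BddAbove {n | ∃ v, f v = railPoint i j n} :=
    ⟨railLength f i j, fun n ⟨v, hv⟩ => le_railLength hv⟩
  obtain ⟨w, hw⟩ := Nat.sSup_mem hne hbdd
  have key : ∀ k, ∀ w, f w = railPoint i j (n + 1 + k) → ∃ v, f v = railPoint i j (n + 1) := by
    intro k
    induction k with
    | zero => exact fun w hw => ⟨w, hw⟩
    | succ k ih =>
      intro w hw
      obtain ⟨u, -, hu⟩ := hf.down (n := n + 1 + k) hw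
      exact ih u hu
  obtain ⟨k, hk⟩ := Nat.exists_eq_add_of_le (show n + 1 ≤ railLength f i j from h)
  obtain ⟨v, hv⟩ := key k w (by rw [← hk]; exact hw)
  obtain ⟨u, huv, hu⟩ := hf.down hv
  exact ⟨u, v, huv.symm, hu, hv⟩

theorem railEdges_subset [Finite V] (hf : IsDrawing G f) {F : SimpleGraph FigurePoint}
    (hF : ∀ u v, G.Adj u v → F.Adj (f u) (f v)) :
    railEdges (railLength f) ⊆ (imageSubgraph G f F hF).edgeSet := by
  rintro e ⟨i, j, n, -, hn, rfl⟩
  exact SimpleGraph.Subgraph.mem_edgeSet.2 (hf.exists_rail_edge hn)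

theorem adj_cases [Finite V] (hf : IsDrawing G f) {u v : V} (h : G.Adj u v) :
    s(f u, f v) ∈ railEdges (railLength f) ∨ ∃ i j n, i ≠ j ∧ HasRung G f i j n ∧
      n ≤ railLength f i j ∧ n ≤ railLength f j i ∧ s(f u, f v) = rung i j n := by
  obtain ⟨i, j, n, hij, he | he⟩ := hf.adj h
  · left
    refine ⟨i, j, n, hij, ?_, he⟩
    rcases Sym2.eq_iff.1 he with ⟨h1, h2⟩ | ⟨h1, h2⟩
    · exact le_railLength h2
    · exact le_railLength h1
  · right
    have hr := hasRung_of_eq h he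
    obtain ⟨u', v', -, hu, hv⟩ := id hr
    exact ⟨i, j, n, hij, hr, le_railLength hu, le_railLength hv, he⟩

/-- A drawing with rungs between any two hubs is a member of a non-bipartite figure. -/
theorem exists_nonbipartiteShape [Finite V] (hf : IsDrawing G f)
    (hr : ∀ i j, i ≠ j → ∃ n, HasRung G f i j n) :
    ∃ (S : NonbipartiteShape) (H : S.figure.Subgraph), S.IsMember H ∧ Nonempty (G ≃g H.coe) := by
  have hlow : ∀ i j, i ≠ j → HasRung G f i j (sInf {n | HasRung G f i j n}) :=
    fun i j hij => Nat.sInf_mem (hr i j hij)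
  let S : NonbipartiteShape :=
    { len := railLength f
      low := fun i j => sInf {n | HasRung G f i j n}
      low_symm := fun i j => by simp only [hasRung_comm (i := i)]
      low_le := fun i j hij => by
        obtain ⟨u, v, -, hu, -⟩ := hlow i j hij
        exact le_railLength hu }
  have hF : ∀ u v, G.Adj u v → S.figure.Adj (f u) (f v) := by
    intro u v h
    rw [NonbipartiteShape.figure, SimpleGraph.fromEdgeSet_adj]
    refine ⟨?_, fun he => h.ne (hf.injective he)⟩
    rcases hf.adj_cases h with h | ⟨i, j, n, hij, h1, h2, h3, h4⟩
    · exact Or.inl h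
    · exact Or.inr ⟨i, j, n, hij, Nat.sInf_le h1, h2, h3, h4⟩
  have hblue : S.blueCycleEdges ⊆ (imageSubgraph G f S.figure hF).edgeSet := by
    rintro e (⟨i, j, n, hij, hn, rfl⟩ | ⟨i, j, hij, rfl⟩)
    · exact hf.railEdges_subset hF ⟨i, j, n, hij, hn.trans_le (S.low_le i j hij), rfl⟩
    · exact SimpleGraph.Subgraph.mem_edgeSet.2 (hlow i j hij)
  exact ⟨S, imageSubgraph G f S.figure hF, ⟨hf.railEdges_subset hF, hblue,
    S.isSmallestOddCycle (SimpleGraph.Subgraph.spanningCoe_le _) hblue⟩,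
    ⟨isoImageSubgraph hf.injective hF⟩⟩

/-- A drawing in which only hub `0` is joined to the other hubs by ladders with rungs is a member
of the bipartite figure. -/
theorem exists_bipartiteShape [Finite V] (hf : IsDrawing G f) (h12 : ∀ n, ¬ HasRung G f 1 2 n)
    (h0 : ∃ v, f v = hub 0)
    (hr : ∀ i, i ≠ 0 → (∃ v, f v = hub i) → ∃ n, HasRung G f 0 i n) :
    ∃ (S : BipartiteShape) (H : S.figure.Subgraph), S.IsMember H ∧ Nonempty (G ≃g H.coe) := by
  have hlow : ∀ i, i ≠ 0 → (∃ v, f v = hub i) →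
      HasRung G f 0 i (sInf {n | HasRung G f 0 i n}) := fun i hi h => Nat.sInf_mem (hr i hi h)
  have h12' : ∀ i j, i ≠ 0 → j ≠ 0 → i ≠ j → ∀ n, ¬ HasRung G f i j n := by
    intro i j hi hj hij n
    rcases ne_cases hij with ⟨rfl, rfl⟩ | ⟨rfl, rfl⟩ | ⟨rfl, rfl⟩ | ⟨rfl, rfl⟩ | ⟨rfl, rfl⟩ |
      ⟨rfl, rfl⟩
    · exact absurd rfl hi
    · exact absurd rfl hj
    · exact h12 n
    · rw [hasRung_comm]; exact h12 n
    · exact absurd rfl hj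
    · exact absurd rfl hi
  have hpos : ∀ {v i}, f v = hub i → ∀ j, j ≠ i → ¬ HasRung G f i j 0 → 1 ≤ railLength f i j := by
    intro v i hv j hj hno
    obtain ⟨u, hu, rfl⟩ := hf.hub_adj hv j hj
    have := hf.adj hu
    rw [hv] at this
    rcases figureAdj_hub this with h | h
    · exact absurd ⟨v, u, hu, hv, h⟩ hno
    · exact le_railLength h
  let S : BipartiteShape :=
    { len := railLength f
      -- An outer hub counts as present when the drawing uses it; `hr` then supplies its ladder with
      -- a rung.
      hasLadder := fun i => ∃ v, f v = hub i
      low := fun i => sInf {n | HasRung G f 0 i n}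
      low_le := fun i hi h => by
        obtain ⟨u, v, -, hu, hv⟩ := hlow i hi h
        exact ⟨le_railLength hu, le_railLength hv⟩
      tail_pos := fun i j hi hj hij ⟨v, hv⟩ => hpos hv j hij.symm (h12' i j hi hj hij 0)
      path_pos := fun i hi h => by
        obtain ⟨v, hv⟩ := h0
        exact hpos hv i hi fun ⟨_, w, _, _, hw⟩ => h ⟨w, hw⟩
      no_rail := fun i j hi hij h => by
        by_contra hne
        obtain ⟨u, v, -, hu, -⟩ := hf.exists_rail_edge (Nat.pos_of_ne_zero hne)
        exact h ⟨u, hu⟩ }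
  have hF : ∀ u v, G.Adj u v → S.figure.Adj (f u) (f v) := by
    intro u v h
    rw [BipartiteShape.figure, SimpleGraph.fromEdgeSet_adj]
    refine ⟨?_, fun he => h.ne (hf.injective he)⟩
    rcases hf.adj_cases h with h | ⟨i, j, n, hij, h1, h2, h3, h4⟩
    · exact Or.inl h
    · right
      by_cases hi : i = 0
      · subst hi
        obtain ⟨-, w, -, -, hw⟩ := id h1
        exact ⟨j, n, hij.symm, hf.exists_hub hw, Nat.sInf_le h1, h2, h3, h4⟩
      · by_cases hj : j = 0
        · subst hj
          obtain ⟨w, -, -, hw, -⟩ := id h1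
          exact ⟨i, n, hi, hf.exists_hub hw, Nat.sInf_le (hasRung_comm.1 h1), h3, h2,
            h4.trans (rung_comm i 0 n)⟩
        · exact absurd h1 (h12' i j hi hj hij n)
  refine ⟨S, imageSubgraph G f S.figure hF, ?_, ⟨isoImageSubgraph hf.injective hF⟩⟩
  rintro e (he | ⟨i, hi, h, rfl⟩)
  · exact hf.railEdges_subset hF he
  · exact SimpleGraph.Subgraph.mem_edgeSet.2 (hlow i hi h)

/-- Rail edges keep the hub at which a rail starts, so a walk from hub i to hub j has to cross a
rung at some rail of i. -/
theorem exists_hasRung_of_connected (hf : IsDrawing G f) (hG : G.Connected) {i j : Fin 3}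
    (hij : i ≠ j) (hi : ∃ v, f v = hub i) (hj : ∃ v, f v = hub j) :
    ∃ k, k ≠ i ∧ ∃ n, HasRung G f i k n := by
  by_contra! hno
  have key : ∀ {u v : V}, G.Walk u v → ((f u).home = i ↔ (f v).home = i) := by
    intro u v p
    induction p with
    | nil => rfl
    | @cons u w v h p ih =>
      rw [← ih]
      obtain ⟨i', j', n, hij', he | he⟩ := hf.adj h
      · rcases Sym2.eq_iff.1 he with ⟨h1, h2⟩ | ⟨h1, h2⟩ <;>
          rw [h1, h2, home_railPoint, home_railPoint]
      · have hr := hasRung_of_eq h he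
        have h1 : i' ≠ i := fun h' => hno j' (h' ▸ hij'.symm) n (h' ▸ hr)
        have h2 : j' ≠ i := fun h' => hno i' (h' ▸ hij') n (hasRung_comm.1 (h' ▸ hr))
        rcases Sym2.eq_iff.1 he with ⟨h3, h4⟩ | ⟨h3, h4⟩ <;>
          rw [h3, h4, home_railPoint, home_railPoint] <;> simp [h1, h2]
  obtain ⟨u, hu⟩ := hi
  obtain ⟨v, hv⟩ := hj
  obtain ⟨p⟩ := hG.preconnected u v
  have := (key p).1 (by rw [hu]; rfl)
  rw [hv] at this
  exact hij this.symm

theorem hasRung_relabel_iff (σ : Equiv.Perm (Fin 3)) {i j : Fin 3} {n : ℕ} :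
    HasRung G (fun v => (f v).relabel σ.symm) i j n ↔ HasRung G f (σ i) (σ j) n := by
  have key : ∀ v i j n, (f v).relabel σ.symm = railPoint i j n ↔
      f v = railPoint (σ i) (σ j) n := by
    intro v i j n
    constructor
    · intro h
      have := congrArg (FigurePoint.relabel σ) h
      rw [relabel_railPoint] at this
      rw [← this]
      simpa using (relabel_symm_relabel σ.symm (f v)).symm
    · intro h
      rw [h, relabel_railPoint]
      simp
  simp only [HasRung, key]

/-- If some two hubs of a drawing are not joined by a rung, then the hubs can be renamed such
that hub `0` is used, there is no rung between the hubs `1` and `2`, and any of these two hubs that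
is used is joined to hub `0` by a rung. -/
theorem exists_middle_hub (hf : IsDrawing G f) (hG : G.Connected)
    {b c : Fin 3} (hbc : b ≠ c) (hno : ∀ n, ¬ HasRung G f b c n) :
    ∃ x y z : Fin 3, x ≠ y ∧ x ≠ z ∧ y ≠ z ∧ (∃ v, f v = hub x) ∧ (∀ n, ¬ HasRung G f y z n) ∧
      ((∃ v, f v = hub y) → ∃ n, HasRung G f x y n) ∧
      ((∃ v, f v = hub z) → ∃ n, HasRung G f x z n) := by
  set a := thirdHub b c with ha
  have hab : a ≠ b := thirdHub_ne_left hbc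
  have hac : a ≠ c := thirdHub_ne_right hbc
  have hcase : ∀ x : Fin 3, x = b ∨ x = c ∨ x = a := eq_or_eq_or_eq_thirdHub hbc
  have hub_of : ∀ {i j n}, HasRung G f i j n → (∃ v, f v = hub i) ∧ ∃ v, f v = hub j :=
    fun ⟨u, v, _, hu, hv⟩ => ⟨hf.exists_hub hu, hf.exists_hub hv⟩
  -- A used hub among b and c is not alone if another hub is used; its rung cannot join b and c, so
  -- it leads to a.
  have toA : ∀ x y, x = b ∧ y = c ∨ x = c ∧ y = b → ∀ j, x ≠ j → (∃ v, f v = hub x) →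
      (∃ v, f v = hub j) → ∃ n, HasRung G f a x n := by
    intro x y hxy j hxj hx hj
    obtain ⟨k, hk, n, hn⟩ := hf.exists_hasRung_of_connected hG hxj hx hj
    rcases hxy with ⟨rfl, rfl⟩ | ⟨rfl, rfl⟩
    · rcases hcase k with rfl | rfl | rfl
      · exact absurd rfl hk
      · exact absurd hn (hno n)
      · exact ⟨n, hasRung_comm.1 hn⟩
    · rcases hcase k with rfl | rfl | rfl
      · exact absurd (hasRung_comm.1 hn) (hno n)
      · exact absurd rfl hk
      · exact ⟨n, hasRung_comm.1 hn⟩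
  by_cases hA : ∃ v, f v = hub a
  · exact ⟨a, b, c, hab, hac, hbc, hA, hno, fun h => toA b c (by simp) a hab.symm h hA,
      fun h => toA c b (by simp) a hac.symm h hA⟩
  -- If a is unused, b and c cannot both be used, so the only used hub serves as the middle one.
  · by_cases hB : ∃ v, f v = hub b
    · refine ⟨b, a, c, hab.symm, hbc, hac, hB, fun n h => hA (hub_of h).1, fun h => absurd h hA,
        fun h => ?_⟩
      obtain ⟨n, hn⟩ := toA b c (by simp) c hbc hB h
      exact absurd (hub_of hn).1 hA
    · have hC : ∃ v, f v = hub c := by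
        obtain ⟨v⟩ := hG.nonempty
        obtain ⟨i, j, n, -, h⟩ := hf.exists_railPoint v
        have := hf.exists_hub h
        rcases hcase i with rfl | rfl | rfl
        · exact absurd this hB
        · exact this
        · exact absurd this hA
      exact ⟨c, a, b, hac.symm, hbc.symm, hab, hC, fun n h => hA (hub_of h).1,
        fun h => absurd h hA, fun h => absurd h hB⟩

theorem exists_shape [Finite V] (hf : IsDrawing G f) (hG : G.Connected) :
    (∃ (S : BipartiteShape) (H : S.figure.Subgraph), S.IsMember H ∧ Nonempty (G ≃g H.coe)) ∨
    (∃ (S : NonbipartiteShape) (H : S.figure.Subgraph), S.IsMember H ∧ Nonempty (G ≃g H.coe)) := by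
  by_cases hall : ∀ i j, i ≠ j → ∃ n, HasRung G f i j n
  · exact Or.inr (hf.exists_nonbipartiteShape hall)
  left
  push Not at hall
  obtain ⟨b, c, hbc, hno⟩ := hall
  obtain ⟨x, y, z, hxy, hxz, hyz, hx, hyzr, hy, hz⟩ := hf.exists_middle_hub hG hbc hno
  obtain ⟨σ, rfl, rfl, rfl⟩ : ∃ σ : Equiv.Perm (Fin 3), σ 0 = x ∧ σ 1 = y ∧ σ 2 = z := by
    clear hx hyzr hy hz
    revert x y z
    decide
  have hhub : ∀ i, (∃ v, (f v).relabel σ.symm = hub i) → ∃ v, f v = hub (σ i) := by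
    rintro i ⟨v, hv⟩
    refine ⟨v, ?_⟩
    have := congrArg (FigurePoint.relabel σ) hv
    exact (relabel_symm_relabel σ.symm (f v)).symm.trans this
  refine (hf.relabel σ.symm).exists_bipartiteShape (fun n => ?_) ?_ fun i hi h => ?_
  · rw [hasRung_relabel_iff]
    exact hyzr n
  · obtain ⟨v, hv⟩ := hx
    exact ⟨v, by rw [hv]; simp [FigurePoint.relabel]⟩
  · simp only [hasRung_relabel_iff]
    obtain rfl | rfl : i = 1 ∨ i = 2 := by
      clear h
      revert i
      decide
    · exact hy (hhub _ h)
    · exact hz (hhub _ h)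

end IsDrawing

/-! ### The characterization -/

theorem mainTheorem4 {V : Type*} [Finite V] (G : SimpleGraph V) (hG : G.Connected) :
    (G.distinguishingChromaticNumber = 3 ∧ G.locatingChromaticNumber = 3) ↔
      ((∃ (S : BipartiteShape) (H : S.figure.Subgraph), S.IsMember H ∧
          Nonempty (G ≃g H.coe) ∧ 2 ≤ Nat.card (H.coe ≃g H.coe) ∧
          H.coe.HasSidePreservingAut) ∨
        (∃ (S : NonbipartiteShape) (H : S.figure.Subgraph), S.IsMember H ∧
          Nonempty (G ≃g H.coe))) := by
  rw [hG.numbers_eq_three_iff]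
  constructor
  · rintro ⟨⟨c, hc⟩, hD⟩
    obtain ⟨f, hf⟩ := hc.exists_isDrawing hG
    rcases hf.exists_shape hG with ⟨S, H, hH, ⟨e⟩⟩ | h
    · left
      have haut : H.coe.HasSidePreservingAut :=
        -- The bipartition of the figure pulls back to a 2-colouring of `G`; as it is not
        -- distinguishing, it provides the automorphism.
        (SimpleGraph.hasSidePreservingAut_of_not_exists
          ((S.sideColoring.comp H.hom).comp e.toHom) hD).of_iso e.symm
      have : Finite H.verts := Finite.of_equiv V e.toEquiv
      exact ⟨S, H, hH, ⟨e⟩, haut.two_le_card, haut⟩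
    · exact Or.inr h
  · rintro (⟨S, H, hH, ⟨e⟩, -, haut⟩ | ⟨S, H, hH, ⟨e⟩⟩)
    · exact ⟨⟨_, (hH.isDrawing hG e).isLocating hG⟩, (haut.of_iso e).not_exists_isDistinguishing hG⟩
    · exact ⟨⟨_, (hH.isDrawing hG e).isLocating hG⟩, fun ⟨c, _⟩ => (hH.not_colorable e).false c⟩
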